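/- **Setting.** Let $N\ge 2$ and let $f_1,\dots,f_N:\mathbb R^d\to\mathbb R$ be differentiable with, for some $\mu>0$ and $L$, $$\tfrac L2\|x-y\|^2\ \ge\ f_i(x)-f_i(y)-\nabla f_i(y)^T(x-y)\ \ge\ \tfrac\mu2\|x-y\|^2\qquad(x,y\in\mathbb R^d).$$ Put $f=\frac1N\sum_{i=1}^N f_i$ with minimizer $x_*$, $F(x_1,\dots,x_N)=\sum_{i=1}^N f_i(x_i)$ on $\mathbb R^{Nd}$, and $x^*=(x_*,\dots,x_*)\in\mathbb R^{Nd}$. Let $W$ be a symmetric doubly stochastic $N\times N$ matrix adapted to a connected undirected graph on $\{1,\dots,N\}$: $W_{ii}>0$ for all $i$ and, for $i\ne j$, $W_{ij}>0$ if $i,j$ are adjacent and $W_{ij}=0$ otherwise. Let $1=\lambda_1^W>\lambda_2^W\ge\dots\ge\lambda_N^W$ be its eigenvalues, assume $\lambda_N^W>0$, and put $\gamma=\max\{|\lambda_2^W|,|\lambda_N^W|\}$ and $\mathcal W=W\otimes I_d$. For a stepsize $\alpha$ let $\beta=\frac{1-\sqrt{\alpha\mu}}{1+\sqrt{\alpha\mu}}$.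 D-ASG is the iteration, for $k\ge0$, $$x_i^{(k+1)}=\sum_{j}W_{ij}y_j^{(k)}-\alpha\,\tilde\nabla f_i\big(y_i^{(k)},w_i^{(k)}\big),\qquad y^{(k)}=(1+\beta)x^{(k)}-\beta x^{(k-1)},$$ started from $x^{(0)}=x^{(-1)}=0$; $\bar x^{(k)}=\frac1N\sum_i x_i^{(k)}$. The random inputs $w_i^{(k)}$ are independent over all $i$ and $k$, and for all $i,k$ $$\mathbb E\big[\tilde\nabla f_i(y_i^{(k)},w_i^{(k)})\,\big|\,y_i^{(k)}\big]=\nabla f_i(y_i^{(k)}),\qquad \mathbb E\big[\|\tilde\nabla f_i(y_i^{(k)},w_i^{(k)})-\nabla f_i(y_i^{(k)})\|^2\,\big|\,y_i^{(k)}\big]\le\sigma^2 .$$ Let $x^\infty\in\mathbb R^{Nd}$ be the solution of $(I-\mathcal W)x^\infty+\alpha\nabla F(x^\infty)=0$, let $F_{\mathcal W,\alpha}(x)=\frac1{2\alpha}x^T(I-\mathcal W)x+F(x)$, let $v=\big(\tfrac1{\sqrt{2\alpha}},\ \sqrt{\tfrac\mu2}-\sqrt{\tfrac1{2\alpha}}\big)^T$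 and $\tilde S_\alpha=vv^T$. Write $V:=V_{S,\alpha}(\xi_0)$ and $\bar V:=V_{\bar S,\alpha}(\bar\xi_0)$, where $$V_{S,\alpha}(\xi)=\xi^T(\tilde S_\alpha\otimes I_{Nd})\xi+F_{\mathcal W,\alpha}(\xi_1+x^\infty)-F_{\mathcal W,\alpha}(x^\infty),\qquad \xi_0=(-x^\infty,-x^\infty),$$ $$V_{\bar S,\alpha}(\bar\xi)=\bar\xi^T(\tilde S_\alpha\otimes I_{d})\bar\xi+f(\bar\xi_1+x_*)-f(x_*),\qquad \bar\xi_0=(-x_*,-x_*),$$ with $\xi_1$, $\bar\xi_1$ the first block. Put $f_i^*=\min f_i$ and $$C_1=\sqrt{2L\textstyle\sum_{i}(f_i(0)-f_i^*)}\,\Big(1+\tfrac{2(L+\mu)}\mu\Big),\qquad B=\frac{4V}\mu+\frac{2\sigma^2N\sqrt\alpha}{\mu\sqrt\mu}(2-\lambda_N^W+\alpha L)+\frac{2C_1^2N\alpha^2}{(1-\gamma)^2},$$ $$D_y^2=4L^2\big((1+\beta)^2+\beta^2\big)B+2\|\nabla F(x^*)\|^2,$$ $$H_1=8\big(1+\tfrac{\mu\alpha}2-\sqrt{\alpha\mu}\big)+\tfrac{2L^2\alpha}\mu+(L\alpha+2+\mu\alpha)\sqrt{\alpha\mu}-2\mu\alpha,$$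 $$H_2=\tfrac2NL^2\big((1+\beta)^2+\beta^2\big)\Big(\tfrac{4D_y^2\alpha}{(1-\gamma)^2}+\tfrac{4\sigma^2N\alpha}{(1-\gamma)^2}+\tfrac{8C_0}{(1-\gamma)^2}\Big),\qquad H_3=\tfrac2NL^2\big((1+\beta)^2+\beta^2\big)\big(B+\|x^*\|^2\big).$$ For $q=1-\frac{\sqrt{\alpha\mu}}2$ let $R_k=\frac{\gamma^{2k}-q^k}{\gamma^2-q}$, read as its limit value $kq^{k-1}$ if $\gamma^2=q$. **Proposition.** There is a constant $C_0>0$, depending only on the problem data (the network and $W$, the $f_i$, $\mu$, $L$, $\sigma$) and not on $\alpha$, on $k$, on the node or on the law of the noise, such that for every $0<\alpha\le\min\{\frac1{L+\mu},\frac{\lambda_N^W}L\}$ and every $k\ge0$ the second moments below are finite and $$\mathbb E\|\bar x^{(k)}-x_*\|^2\le q^k\frac{2\bar V}\mu+\frac{8\sqrt\alpha}{\gamma^2\mu\sqrt\mu}H_1H_3R_k+\frac{2}{\mu^2}\alpha H_1H_2+\frac{2\sigma^2\sqrt\alpha}{\mu\sqrt\mu N}\Big(1+\frac{\sqrt{\alpha\mu}}2\Big)(1+\alpha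 L),$$ and for every $i=1,\dots,N$ $$\begin{aligned}\mathbb E\|x_i^{(k)}-x_*\|^2\le{}& q^k\frac{4\bar V}\mu+\frac{16\sqrt\alpha}{\gamma^2\mu\sqrt\mu}H_1H_3R_k+\frac4{\mu^2}\alpha H_1H_2+16\gamma^{2k}\big(B+\|x^*\|^2\big)\\&+\frac{8D_y^2\alpha^2}{(1-\gamma)^2}+\frac{8\sigma^2N\alpha^2}{(1-\gamma)^2}+\frac{16C_0\alpha}{(1-\gamma)^2}+\frac{4\sigma^2\sqrt\alpha}{\mu\sqrt\mu N}\Big(1+\frac{\sqrt{\alpha\mu}}2\Big)(1+\alpha L).\end{aligned}$$ -/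

import Mathlib

open MeasureTheory ProbabilityTheory

noncomputable section

/-- The space `ℝ^d` with its Euclidean norm. -/
abbrev Vec (d : ℕ) : Type := EuclideanSpace ℝ (Fin d)

/-- The space `ℝ^{Nd}` of stacked vectors `x = (x_1, …, x_N)`, `x_i ∈ ℝ^d`, with its Euclidean norm
`‖x‖² = ∑ i, ‖x_i‖²`. -/
abbrev Stack (N d : ℕ) : Type := PiLp 2 (fun _ : Fin N => Vec d)

/-- The class `S_{μ,L}`: differentiable functions with
`(L/2)‖x-y‖² ≥ g x - g y - ⟪∇g y, x - y⟫ ≥ (μ/2)‖x-y‖²` for all `x, y`. -/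
structure StronglyConvexSmooth {d : ℕ} (μ L : ℝ) (g : Vec d → ℝ) : Prop where
  differentiable : Differentiable ℝ g
  upper : ∀ x y, g x - g y - inner ℝ (gradient g y) (x - y) ≤ L / 2 * ‖x - y‖ ^ 2
  lower : ∀ x y, μ / 2 * ‖x - y‖ ^ 2 ≤ g x - g y - inner ℝ (gradient g y) (x - y)

/-- `W` is a symmetric doubly stochastic weight matrix for the network `G`: weights are positive on
edges and on the diagonal, and vanish between distinct non-adjacent nodes. -/
structure IsWeightMatrix {N : ℕ} (G : SimpleGraph (Fin N)) (W : Matrix (Fin N) (Fin N) ℝ) :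
    Prop where
  symm : W.IsSymm
  row_sum : ∀ i, ∑ j, W i j = 1
  diag_pos : ∀ i, 0 < W i i
  edge_pos : ∀ i j, G.Adj i j → 0 < W i j
  nonedge : ∀ i j, i ≠ j → ¬ G.Adj i j → W i j = 0

/-- The data of the decentralized problem `min_x (1/N) ∑ i, f_i x` over a connected network with
`N ≥ 2` nodes, together with the noise level `σ` of the gradient estimates. -/
structure DecentralizedProblem (N d : ℕ) where
  graph : SimpleGraph (Fin N)
  W : Matrix (Fin N) (Fin N) ℝ
  f : Fin N → Vec d → ℝ
  μ : ℝ
  L : ℝ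
  σ : ℝ
  two_le : 2 ≤ N
  connected : graph.Connected
  weight : IsWeightMatrix graph W
  mu_pos : 0 < μ
  local_class : ∀ i, StronglyConvexSmooth μ L (f i)

/-- The noisy D-ASG recursion along one realization `w k i` of the random inputs. The value at `k`
is the pair `(x^{(k)}, x^{(k-1)})`, and
`x_i^{(k+1)} = ∑ j, W_ij y_j^{(k)} - α G_i(y_i^{(k)}, w_i^{(k)})` with
`y^{(k)} = (1+β) x^{(k)} - β x^{(k-1)}`; here `G_i(x, w)` is the gradient estimate of node `i`. -/
def dasgPair {N d : ℕ} {Z : Type*} (W : Matrix (Fin N) (Fin N) ℝ) (α β : ℝ)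
    (G : Fin N → Vec d → Z → Vec d) (xinit xprev : Stack N d) (w : ℕ → Fin N → Z) :
    ℕ → Stack N d × Stack N d
  | 0 => (xinit, xprev)
  | k + 1 =>
    let s := dasgPair W α β G xinit xprev w k
    let y : Stack N d := (1 + β) • s.1 - β • s.2
    (WithLp.toLp 2 (fun i => ∑ j, W i j • y j - α • G i (y i) (w k i)), s.1)

/-- The iterate `x^{(k)}` of D-ASG. -/
def dasgX {N d : ℕ} {Z : Type*} (W : Matrix (Fin N) (Fin N) ℝ) (α β : ℝ)
    (G : Fin N → Vec d → Z → Vec d) (xinit xprev : Stack N d) (w : ℕ → Fin N → Z) (k : ℕ) :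
    Stack N d :=
  (dasgPair W α β G xinit xprev w k).1

/-- The extrapolated point `y^{(k)} = (1+β) x^{(k)} - β x^{(k-1)}` of D-ASG. -/
def dasgY {N d : ℕ} {Z : Type*} (W : Matrix (Fin N) (Fin N) ℝ) (α β : ℝ)
    (G : Fin N → Vec d → Z → Vec d) (xinit xprev : Stack N d) (w : ℕ → Fin N → Z) (k : ℕ) :
    Stack N d :=
  (1 + β) • (dasgPair W α β G xinit xprev w k).1 - β • (dasgPair W α β G xinit xprev w k).2

/-- The node average `(1/N) ∑ i, x_i`. -/
def nodeAverage {N d : ℕ} (x : Stack N d) : Vec d := (N : ℝ)⁻¹ • ∑ i, x i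

/-- The rank-one matrix `v vᵀ` with `v = (1/√(2α), √(μ/2) - √(1/(2α)))`. -/
def lyapunovMatrix (μ α : ℝ) : Matrix (Fin 2) (Fin 2) ℝ :=
  let v : Fin 2 → ℝ := ![1 / √(2 * α), √(μ / 2) - √(1 / (2 * α))]
  Matrix.vecMulVec v v

/-- `ξᵀ (S ⊗ I) ξ + g(ξ_1 + z) - g(z)` for `ξ = (ξ_1, ξ_2)`. -/
def lyapunov {E : Type*} [NormedAddCommGroup E] [InnerProductSpace ℝ E]
    (S : Matrix (Fin 2) (Fin 2) ℝ) (g : E → ℝ) (z : E) (ξ : Fin 2 → E) : ℝ :=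
  (∑ a, ∑ b, S a b * inner ℝ (ξ a) (ξ b)) + g (ξ 0 + z) - g z

/-- The quotient `(a^k - b^k)/(a - b)`, continued by its limit value `k a^{k-1}` to `a = b`. -/
def powerQuotient (a b : ℝ) (k : ℕ) : ℝ :=
  if a = b then k * a ^ (k - 1) else (a ^ k - b ^ k) / (a - b)

namespace DecentralizedProblem

variable {N d : ℕ} (P : DecentralizedProblem N d)

/-- The global objective `f = (1/N) ∑ i, f_i`. -/
def objective (x : Vec d) : ℝ := (N : ℝ)⁻¹ * ∑ i, P.f i x

/-- `F(x_1, …, x_N) = ∑ i, f_i(x_i)`. -/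
def F (x : Stack N d) : ℝ := ∑ i, P.f i (x i)

/-- The action of `W ⊗ I_d` on stacked vectors. -/
def mix (x : Stack N d) : Stack N d := WithLp.toLp 2 (fun i => ∑ j, P.W i j • x j)

/-- `x` solves `(I - W ⊗ I_d) x + α ∇F(x) = 0`, i.e. `x = x^∞` is the fixed point of the noiseless
iteration with stepsize `α`. -/
def IsFixedPoint (α : ℝ) (x : Stack N d) : Prop := (x - P.mix x) + α • gradient P.F x = 0

/-- The penalized objective `F_{W,α}(x) = (1/(2α)) xᵀ (I - W ⊗ I_d) x + F(x)`. -/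
def penalized (α : ℝ) (x : Stack N d) : ℝ := 1 / (2 * α) * inner ℝ x (x - P.mix x) + P.F x

theorem isHermitian_W : P.W.IsHermitian := by
  rw [Matrix.IsHermitian, Matrix.conjTranspose_eq_transpose_of_trivial]
  exact P.weight.symm

/-- The eigenvalues of `W` with multiplicity, in decreasing order; index `j` is `λ_{j+1}`. -/
def eigenvalue (j : Fin N) : ℝ :=
  P.isHermitian_W.eigenvalues₀ (Fin.cast (Fintype.card_fin N).symm j)

/-- The second largest eigenvalue of `W`. -/
def lambdaTwo : ℝ := P.eigenvalue ⟨1, P.two_le⟩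

/-- The smallest eigenvalue of `W`. -/
def lambdaMin : ℝ := P.eigenvalue ⟨N - 1, Nat.sub_lt (lt_of_lt_of_le Nat.zero_lt_two P.two_le) Nat.one_pos⟩

/-- `γ = max {|λ_2|, |λ_N|}`. -/
def gamma : ℝ := max |P.lambdaTwo| |P.lambdaMin|

/-- The momentum parameter `β = (1 - √(αμ))/(1 + √(αμ))`. -/
def beta (α : ℝ) : ℝ := (1 - √(α * P.μ)) / (1 + √(α * P.μ))

/-- `C_1 = √(2L ∑ i, (f_i(0) - min f_i)) (1 + 2(L+μ)/μ)`. -/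
def C₁ : ℝ :=
  √(2 * P.L * ∑ i, (P.f i 0 - ⨅ x, P.f i x)) * (1 + 2 * (P.L + P.μ) / P.μ)

/-- The value `V_{S,α}(ξ_0)`, for the initialization `x^{(0)} = x^{(-1)} = 0`. -/
def V₀ (α : ℝ) (xinf : Stack N d) : ℝ :=
  lyapunov (lyapunovMatrix P.μ α) (P.penalized α) xinf ![0 - xinf, 0 - xinf]

/-- The value `V_{S̄,α}(ξ̄_0)`, for the initialization `x^{(0)} = x^{(-1)} = 0`. -/
def Vbar₀ (α : ℝ) (xs : Vec d) : ℝ :=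
  lyapunov (lyapunovMatrix P.μ α) P.objective xs ![0 - xs, 0 - xs]

/-- `x^* = (x_*, …, x_*)`. -/
def copies (N : ℕ) {d : ℕ} (xs : Vec d) : Stack N d := WithLp.toLp 2 (fun _ => xs)

/-- The recurring expression
`4 V_{S,α}(ξ_0)/μ + (2σ²N√α/(μ√μ))(2 - λ_N + αL) + 2 C_1² N α²/(1-γ)²`. -/
def B (α : ℝ) (xinf : Stack N d) : ℝ :=
  4 * (P.V₀ α xinf / P.μ)
    + 2 * P.σ ^ 2 * N * √α / (P.μ * √P.μ) * (2 - P.lambdaMin + α * P.L)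
    + 2 * P.C₁ ^ 2 * N * α ^ 2 / (1 - P.gamma) ^ 2

/-- `D_y²`. -/
def DySq (α : ℝ) (xs : Vec d) (xinf : Stack N d) : ℝ :=
  4 * P.L ^ 2 * ((1 + P.beta α) ^ 2 + P.beta α ^ 2) * P.B α xinf
    + 2 * ‖gradient P.F (copies N xs)‖ ^ 2

def H₁ (α : ℝ) : ℝ :=
  8 * (1 + P.μ * α / 2 - √(α * P.μ)) + 2 * P.L ^ 2 * α / P.μ
    + (P.L * α + 2 + P.μ * α) * √(α * P.μ) - 2 * P.μ * α

def H₂ (C₀ α : ℝ) (xs : Vec d) (xinf : Stack N d) : ℝ :=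
  2 / N * P.L ^ 2 * ((1 + P.beta α) ^ 2 + P.beta α ^ 2)
    * (4 * P.DySq α xs xinf * α / (1 - P.gamma) ^ 2
      + 4 * P.σ ^ 2 * N * α / (1 - P.gamma) ^ 2
      + 8 * C₀ / (1 - P.gamma) ^ 2)

def H₃ (α : ℝ) (xs : Vec d) (xinf : Stack N d) : ℝ :=
  2 / N * P.L ^ 2 * ((1 + P.beta α) ^ 2 + P.beta α ^ 2)
    * (P.B α xinf + ‖copies N xs‖ ^ 2)

/-- Noise assumption for D-ASG started from zero with stepsize `α` and momentum `β`. The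
gradient estimates are `G_i(y_i^{(k)}, w_i^{(k)})`, the random inputs `w_i^{(k)}` are independent
over all nodes and iterations, and, conditionally on the query point `y_i^{(k)}`, the estimate is
unbiased with variance at most `σ²`. -/
structure NoiseAssumption {Ω Z : Type*} [MeasurableSpace Ω] [MeasurableSpace Z]
    (Pr : Measure Ω) (α β : ℝ) (G : Fin N → Vec d → Z → Vec d) (w : ℕ → Fin N → Ω → Z) :
    Prop where
  measurable_oracle : ∀ i, Measurable (Function.uncurry (G i))
  measurable_input : ∀ k i, Measurable (w k i)
  indep : iIndepFun (fun p : ℕ × Fin N => w p.1 p.2) Pr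
  unbiased : ∀ k i,
    let y : Ω → Vec d := fun ω => dasgY P.W α β G 0 0 (fun t j => w t j ω) k i
    Pr[fun ω => G i (y ω) (w k i ω) | MeasurableSpace.comap y inferInstance]
      =ᵐ[Pr] fun ω => gradient (P.f i) (y ω)
  finite_variance : ∀ k i,
    let y : Ω → Vec d := fun ω => dasgY P.W α β G 0 0 (fun t j => w t j ω) k i
    Integrable (fun ω => ‖G i (y ω) (w k i ω) - gradient (P.f i) (y ω)‖ ^ 2) Pr
  variance_le : ∀ k i,
    let y : Ω → Vec d := fun ω => dasgY P.W α β G 0 0 (fun t j => w t j ω) k i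
    Pr[fun ω => ‖G i (y ω) (w k i ω) - gradient (P.f i) (y ω)‖ ^ 2 |
        MeasurableSpace.comap y inferInstance]
      ≤ᵐ[Pr] fun _ => P.σ ^ 2

end DecentralizedProblem

end

/-! Everything rests on one estimate for accelerated gradient descent. Put `s = √(αμ)` and `V = ‖(x
- z) - (1 - s)(x' - z)‖²/(2α) + g x - g z`, where `x, x'` are the current and previous points and
`z` is the minimizer. If `αL ≤ 1`, an exact step contracts `V` by `1 - s`. Giving up half of this
contraction pays for a bias `b` in the gradient at cost of order `(α/s)‖b‖²`; a noise `n` costs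
`(α/2)(1 + αL)‖n‖²` plus a term linear in `n` that vanishes in expectation
(`CurvatureBounds.asg_step_bias`, `CurvatureBounds.integral_asgLyapunov_le`).

The estimate is used twice. D-ASG on stacked vectors is unbiased accelerated descent on the
penalized objective, whose smoothness constant `Λ` satisfies `αΛ = 1 - λ_N + αL ≤ 1`. Hence the
second moments of the iterates and of the gradient estimates are bounded uniformly in `k` and `α`
(`integral_norm_sq_iterate_le`, `integral_norm_sq_gradient_le`). The node average performs
accelerated descent on `f`; its bias is controlled by the disagreement of the nodes and its noise
has variance at most `σ²/N` (`integral_norm_sq_nodeAverage_sub_le`).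

The disagreement is treated in the eigenbasis of `W`. A mode with eigenvalue `0 < l < 1` follows a
momentum recursion started at zero and forced by `α` times a bounded gradient. A quadratic energy
contracts at rate `1 - (1 - l)/2`, uniformly in `β ∈ [0, 1]` (`momentum_energy_step`), so the
expected squared disagreement is `O(α²)` with a constant free of `α` and `k`. Connectedness makes
`1` a simple eigenvalue, so this covers all disagreement.

These bounds have the stated initial and noise terms, up to the extra factor `1 + s/2` in the claim,
plus `O(α)` contributions that the `C₀` terms absorb once `C₀` is large. The remaining summands,
those with `B`, `D_y²` and `H₃ R_k`, are nonnegative and are simply added. -/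

noncomputable section

/-! ### Accelerated gradient steps with inexact gradients -/

/-- `g'` is a gradient map for `g`, with quadratic lower and upper bounds of curvature `μ`, `L`. -/
structure CurvatureBounds {E : Type*} [NormedAddCommGroup E] [InnerProductSpace ℝ E]
    (μ L : ℝ) (g : E → ℝ) (g' : E → E) : Prop where
  upper : ∀ x y, g x - g y - inner ℝ (g' y) (x - y) ≤ L / 2 * ‖x - y‖ ^ 2
  lower : ∀ x y, μ / 2 * ‖x - y‖ ^ 2 ≤ g x - g y - inner ℝ (g' y) (x - y)

/-- The Lyapunov function of accelerated gradient descent, with `s = √(αμ)`. -/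
def asgLyapunov {E : Type*} [NormedAddCommGroup E] [InnerProductSpace ℝ E]
    (α s : ℝ) (g : E → ℝ) (z x x' : E) : ℝ :=
  1 / (2 * α) * ‖(x - z) - (1 - s) • (x' - z)‖ ^ 2 + (g x - g z)

section Deterministic

variable {E : Type*} [NormedAddCommGroup E] [InnerProductSpace ℝ E]

theorem norm_add_sq_le_two (a b : E) : ‖a + b‖ ^ 2 ≤ 2 * ‖a‖ ^ 2 + 2 * ‖b‖ ^ 2 := by
  have := parallelogram_law_with_norm ℝ a b
  nlinarith [sq_nonneg ‖a - b‖]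

theorem norm_sub_sq_le_two (a b : E) : ‖a - b‖ ^ 2 ≤ 2 * ‖a‖ ^ 2 + 2 * ‖b‖ ^ 2 := by
  have := parallelogram_law_with_norm ℝ a b
  nlinarith [sq_nonneg ‖a + b‖]

theorem abs_inner_le_young {t : ℝ} (ht : 0 < t) (a b : E) :
    |inner ℝ a b| ≤ t / 2 * ‖a‖ ^ 2 + 1 / (2 * t) * ‖b‖ ^ 2 := by
  refine (abs_real_inner_le_norm a b).trans ?_
  have h : 0 ≤ (t * ‖a‖ - ‖b‖) ^ 2 / (2 * t) := by positivity
  have : (t * ‖a‖ - ‖b‖) ^ 2 / (2 * t)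
      = t / 2 * ‖a‖ ^ 2 + 1 / (2 * t) * ‖b‖ ^ 2 - ‖a‖ * ‖b‖ := by field_simp; ring
  linarith

namespace CurvatureBounds

variable {μ L : ℝ} {g : E → ℝ} {g' : E → E}

/-- Compare two bounds at the test point `x - v/L`, a gradient step from `x` for `g` minus its
linear part at `y`: the upper bound based at `x` and the lower bound based at `y`. Lipschitz
continuity of the gradient map, which is not part of the hypotheses, follows from this. -/
theorem norm_sub_sq_le (h : CurvatureBounds μ L g g') (hμ : 0 ≤ μ) (hL : 0 < L) (x y : E) :
    1 / (2 * L) * ‖g' x - g' y‖ ^ 2 ≤ g x - g y - inner ℝ (g' y) (x - y) := by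
  set v := g' x - g' y with hv
  have h1 := h.upper (x - (1 / L) • v) x
  have h2 := h.lower (x - (1 / L) • v) y
  have h3 : 0 ≤ μ / 2 * ‖x - (1 / L) • v - y‖ ^ 2 := by positivity
  have e1 : x - (1 / L) • v - x = -((1 / L) • v) := by abel
  have e2 : x - (1 / L) • v - y = (x - y) - (1 / L) • v := by abel
  rw [e1, inner_neg_right, inner_smul_right, norm_neg, norm_smul, mul_pow, Real.norm_eq_abs,
    sq_abs] at h1
  rw [e2, inner_sub_right, inner_smul_right] at h2
  rw [e2] at h3
  have h4 : inner ℝ (g' x) v - inner ℝ (g' y) v = ‖v‖ ^ 2 := by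
    rw [← inner_sub_left, ← hv, real_inner_self_eq_norm_sq]
  have h5 : L / 2 * ((1 / L) ^ 2 * ‖v‖ ^ 2) = 1 / (2 * L) * ‖v‖ ^ 2 := by field_simp
  have h6 : 1 / L * inner ℝ (g' x) v - 1 / L * inner ℝ (g' y) v = 2 * (1 / (2 * L) * ‖v‖ ^ 2) := by
    rw [← mul_sub, h4]; field_simp
  linarith

theorem lipschitz (h : CurvatureBounds μ L g g') (hμ : 0 ≤ μ) (hL : 0 < L) (x y : E) :
    ‖g' x - g' y‖ ≤ L * ‖x - y‖ := by
  have h1 := (h.norm_sub_sq_le hμ hL x y).trans (h.upper x y)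
  have h2 : ‖g' x - g' y‖ ^ 2 ≤ (L * ‖x - y‖) ^ 2 := by
    have : 1 / (2 * L) * ‖g' x - g' y‖ ^ 2 * (2 * L) ≤ L / 2 * ‖x - y‖ ^ 2 * (2 * L) := by gcongr
    have e : 1 / (2 * L) * ‖g' x - g' y‖ ^ 2 * (2 * L) = ‖g' x - g' y‖ ^ 2 := by field_simp
    nlinarith
  exact (abs_le_of_sq_le_sq' h2 (by positivity)).2

theorem continuous_gradient (h : CurvatureBounds μ L g g') (hμ : 0 ≤ μ) (hL : 0 < L) :
    Continuous g' := by
  refine (LipschitzWith.of_dist_le_mul (K := L.toNNReal) fun x y => ?_).continuous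
  rw [dist_eq_norm, dist_eq_norm, Real.coe_toNNReal _ hL.le]
  exact h.lipschitz hμ hL x y

/-- The gradient map vanishes at a minimizer. -/
theorem gradient_eq_zero (h : CurvatureBounds μ L g g') (hL : 0 < L) {z : E}
    (hz : ∀ x, g z ≤ g x) : g' z = 0 := by
  have h1 := h.upper (z - (1 / L) • g' z) z
  have e1 : z - (1 / L) • g' z - z = -((1 / L) • g' z) := by abel
  rw [e1, inner_neg_right, inner_smul_right, norm_neg, norm_smul, mul_pow, Real.norm_eq_abs,
    sq_abs, real_inner_self_eq_norm_sq] at h1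
  have h2 := hz (z - (1 / L) • g' z)
  have h5 : L / 2 * ((1 / L) ^ 2 * ‖g' z‖ ^ 2) = 1 / L * ‖g' z‖ ^ 2 / 2 := by field_simp
  have h6 : 1 / L * ‖g' z‖ ^ 2 ≤ 0 := by linarith
  have h7 : ‖g' z‖ ^ 2 ≤ 0 := by
    by_contra! hc
    have : 0 < 1 / L * ‖g' z‖ ^ 2 := by positivity
    linarith
  have : ‖g' z‖ = 0 := by nlinarith [norm_nonneg (g' z)]
  exact norm_eq_zero.mp this

theorem lower_of_stationary (h : CurvatureBounds μ L g g') {z : E} (hz : g' z = 0) (x : E) :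
    μ / 2 * ‖x - z‖ ^ 2 ≤ g x - g z := by
  simpa [hz] using h.lower x z

theorem upper_of_stationary (h : CurvatureBounds μ L g g') {z : E} (hz : g' z = 0) (x : E) :
    g x - g z ≤ L / 2 * ‖x - z‖ ^ 2 := by
  simpa [hz] using h.upper x z

/-- The Polyak–Łojasiewicz inequality. Leaving `x` arbitrary avoids any appeal to a minimizer of the
local functions. -/
theorem sub_le_of_gradient (h : CurvatureBounds μ L g g') (hμ : 0 < μ) (x y : E) :
    g y - g x ≤ 1 / (2 * μ) * ‖g' y‖ ^ 2 := by
  have h1 := h.lower x y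
  have h2 := abs_inner_le_young (t := 1 / μ) (by positivity) (g' y) (x - y)
  have h3 := neg_abs_le (inner ℝ (g' y) (x - y))
  have h4 : 1 / μ / 2 * ‖g' y‖ ^ 2 + 1 / (2 * (1 / μ)) * ‖x - y‖ ^ 2
    = 1 / (2 * μ) * ‖g' y‖ ^ 2 + μ / 2 * ‖x - y‖ ^ 2 := by field_simp
  linarith

theorem asgLyapunov_nonneg (h : CurvatureBounds μ L g g') (hμ : 0 ≤ μ) {α : ℝ} (hα : 0 < α)
    (s : ℝ) {z : E} (hz : g' z = 0) (x x' : E) : 0 ≤ asgLyapunov α s g z x x' := by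
  have := h.lower_of_stationary hz x
  have h2 : 0 ≤ μ / 2 * ‖x - z‖ ^ 2 := by positivity
  unfold asgLyapunov
  have : 0 ≤ 1 / (2 * α) * ‖(x - z) - (1 - s) • (x' - z)‖ ^ 2 := by positivity
  linarith

theorem norm_sub_sq_le_asgLyapunov (h : CurvatureBounds μ L g g') {α : ℝ} (hα : 0 < α)
    (hμ : 0 < μ) (s : ℝ) {z : E} (hz : g' z = 0) (x x' : E) :
    ‖x - z‖ ^ 2 ≤ 2 / μ * asgLyapunov α s g z x x' := by
  have := h.lower_of_stationary hz x
  have h3 : 0 ≤ 1 / (2 * α) * ‖(x - z) - (1 - s) • (x' - z)‖ ^ 2 := by positivity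
  have : μ / 2 * ‖x - z‖ ^ 2 ≤ asgLyapunov α s g z x x' := by unfold asgLyapunov; linarith
  calc ‖x - z‖ ^ 2 = 2 / μ * (μ / 2 * ‖x - z‖ ^ 2) := by field_simp
    _ ≤ _ := by gcongr

/-- One inexact accelerated gradient step, with error `e` in the gradient. -/
theorem asg_step (h : CurvatureBounds μ L g g') {α s : ℝ} (hα : 0 < α) (hs : 0 ≤ s)
    (hs1 : s ≤ 1) (hsq : s ^ 2 = α * μ) (hαL : α * L ≤ 1) (z x x' y e xn : E)
    (hy : y - x = ((1 - s) / (1 + s)) • (x - x')) (hxn : xn = y - α • (g' y + e)) :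
    asgLyapunov α s g z xn x ≤ (1 - s) * asgLyapunov α s g z x x'
      - inner ℝ ((y - x) + s • (x - z) - (L * α ^ 2) • g' y) e
      + α / 2 * (1 + L * α) * ‖e‖ ^ 2 := by
  obtain ⟨T, hT⟩ : ∃ T, T = y - x := ⟨_, rfl⟩
  obtain ⟨X, hX⟩ : ∃ X, X = x - z := ⟨_, rfl⟩
  obtain ⟨v, hv⟩ : ∃ v, v = g' y := ⟨_, rfl⟩
  have hu : (x - z) - (1 - s) • (x' - z) = s • X + (1 + s) • T := by
    have h1 : (1 + s) • T = (1 - s) • (x - x') := by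
      rw [hT, hy, smul_smul]; congr 1; field_simp
    rw [h1, hX]; module
  -- The choice `β = (1 - s)/(1 + s)` makes the old and new squared vectors in the Lyapunov function
  -- combinations of `X`, `T` and, for the new one, the gradient estimate `v + e`.
  have hp : (xn - z) - (1 - s) • (x - z) = T + s • X - α • (v + e) := by
    rw [hxn, hT, hX, hv]; module
  have h1 := h.upper xn y
  have h2 := h.lower x y
  have h3 := h.lower z y
  have e1 : xn - y = -(α • (v + e)) := by rw [hxn, hv]; abel
  have e2 : x - y = -T := by rw [hT]; abel
  have e3 : z - y = -(X + T) := by rw [hT, hX]; abel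
  have hμ' : μ = s ^ 2 / α := by rw [hsq]; field_simp
  rw [e1, ← hv] at h1
  rw [e2, ← hv] at h2
  rw [e3, ← hv] at h3
  unfold asgLyapunov
  rw [hu, hp, ← hT, ← hX, ← hv]
  simp only [← real_inner_self_eq_norm_sq, inner_add_left, inner_add_right, inner_sub_left,
    inner_sub_right, inner_smul_left, inner_smul_right, inner_neg_left, inner_neg_right,
    conj_trivial, real_inner_comm X T, real_inner_comm v T, real_inner_comm v X,
    real_inner_comm e T, real_inner_comm e X, real_inner_comm e v] at h1 h2 h3 ⊢
  have p1 : 0 ≤ s * (1 - s ^ 2) * (1 / (2 * α)) * inner ℝ T T := by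
    have : 0 ≤ 1 - s ^ 2 := by nlinarith
    have := real_inner_self_nonneg (x := T)
    positivity
  have p2 : 0 ≤ α / 2 * (1 - α * L) * inner ℝ v v := by
    have : 0 ≤ 1 - α * L := by linarith
    have := real_inner_self_nonneg (x := v)
    positivity
  have h2' := mul_le_mul_of_nonneg_left h2 (sub_nonneg.mpr hs1)
  have h3' := mul_le_mul_of_nonneg_left h3 hs
  subst hμ'
  have hα0 := hα.ne'
  -- With `μ = s²/α` the claim is an exact sum of five nonnegative quantities: smoothness from `y`
  -- to `xn`, the lower bound at `x` with weight `1 - s` and at `z` with weight `s`, and the two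
  -- squares `p1`, `p2`.
  rw [← sub_nonneg] at h1 h2' h3' ⊢
  refine (add_nonneg (add_nonneg (add_nonneg (add_nonneg h1 h2') h3') p1) p2).trans_eq ?_
  field_simp
  ring

/-- One accelerated gradient step with a bias `b` and a noise `n` in the gradient. -/
theorem asg_step_bias (h : CurvatureBounds μ L g g') (hμ : 0 < μ) (hL : 0 < L) {α s : ℝ}
    (hα : 0 < α) (hs : 0 < s)
    (hs1 : s ≤ 1) (hsq : s ^ 2 = α * μ) (hαL : α * L ≤ 1) {z : E} (hz : g' z = 0)
    (x x' y b n xn : E)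
    (hy : y - x = ((1 - s) / (1 + s)) • (x - x')) (hxn : xn = y - α • (g' y + (b + n))) :
    asgLyapunov α s g z xn x ≤ (1 - s / 2) * asgLyapunov α s g z x x'
      + ((12 + 4 * L / μ) * α / s + α) * ‖b‖ ^ 2
      - inner ℝ ((y - x) + s • (x - z) - (L * α ^ 2) • g' y - (α * (1 + L * α)) • b) n
      + α / 2 * (1 + L * α) * ‖n‖ ^ 2 := by
  have key := h.asg_step hα hs.le hs1 hsq hαL z x x' y (b + n) xn hy hxn
  set V := asgLyapunov α s g z x x' with hV
  obtain ⟨A, hA⟩ : ∃ A, A = (y - x) + s • (x - z) - (L * α ^ 2) • g' y := ⟨_, rfl⟩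
  rw [← hA] at key ⊢
  have hV0 : 0 ≤ V := h.asgLyapunov_nonneg hμ.le hα s hz x x'
  have hX : ‖x - z‖ ^ 2 ≤ 2 / μ * V := h.norm_sub_sq_le_asgLyapunov hα hμ s hz x x'
  obtain ⟨u, hu⟩ : ∃ u, u = (x - z) - (1 - s) • (x' - z) := ⟨_, rfl⟩
  have hu2 : ‖u‖ ^ 2 ≤ 2 * α * V := by
    have h1 := h.lower_of_stationary hz x
    have h2 : 0 ≤ μ / 2 * ‖x - z‖ ^ 2 := by positivity
    have h3 : 1 / (2 * α) * ‖u‖ ^ 2 ≤ V := by rw [hV, hu]; unfold asgLyapunov; linarith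
    calc ‖u‖ ^ 2 = 2 * α * (1 / (2 * α) * ‖u‖ ^ 2) := by field_simp
      _ ≤ _ := by gcongr
  have hs1' : (1 + s) ≠ 0 := by positivity
  have hT : (1 + s) • (y - x) = u - s • (x - z) := by
    rw [hy, smul_smul, hu]
    have : (1 + s) * ((1 - s) / (1 + s)) = 1 - s := by field_simp
    rw [this]; module
  have hinv : (1 + s)⁻¹ ≤ 1 := inv_le_one_of_one_le₀ (by linarith)
  have hinv0 : 0 ≤ (1 + s)⁻¹ := by positivity
  -- Multiplication by `1 + s` turns this vector into `u + s²(x - z)`, and both summands are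
  -- controlled by `V`; the factor `s²` supplies the `α` missing from the bound on `‖x - z‖²`.
  have hw : ‖(y - x) + s • (x - z)‖ ^ 2 ≤ 8 * α * V := by
    have e : (y - x) + s • (x - z) = (1 + s)⁻¹ • (u + s ^ 2 • (x - z)) := by
      rw [eq_inv_smul_iff₀ hs1', smul_add, hT]; module
    rw [e, norm_smul, Real.norm_of_nonneg hinv0, mul_pow]
    have h1 := norm_add_sq_le_two u (s ^ 2 • (x - z))
    rw [norm_smul, Real.norm_of_nonneg (by positivity), mul_pow] at h1
    have h2 : (s ^ 2) ^ 2 * ‖x - z‖ ^ 2 ≤ 2 * α * V := by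
      calc (s ^ 2) ^ 2 * ‖x - z‖ ^ 2 ≤ (s ^ 2) ^ 2 * (2 / μ * V) := by gcongr
        _ = s ^ 2 * (2 * α * V) := by rw [hsq]; field_simp
        _ ≤ 1 * (2 * α * V) := by gcongr; nlinarith
        _ = _ := one_mul _
    calc _ ≤ (1 : ℝ) ^ 2 * ‖u + s ^ 2 • (x - z)‖ ^ 2 := by gcongr
      _ ≤ _ := by linarith
  have hg : ‖(L * α ^ 2) • g' y‖ ^ 2 ≤ 4 * α * V * (1 + L / μ) := by
    have h1 : ‖g' y‖ ≤ L * ‖y - z‖ := by simpa [hz] using h.lipschitz hμ.le hL y z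
    have e : y - z = (1 + s)⁻¹ • ((x - z) + u) := by
      rw [eq_inv_smul_iff₀ hs1']
      have : y - z = (y - x) + (x - z) := by abel
      rw [this, smul_add, hT]; module
    have h2 : ‖y - z‖ ≤ ‖(x - z) + u‖ := by
      rw [e, norm_smul, Real.norm_of_nonneg hinv0]
      exact mul_le_of_le_one_left (norm_nonneg _) hinv
    have h3 := norm_add_sq_le_two (x - z) u
    have hLα : 0 ≤ L * α := by positivity
    have hLα1 : L * α ≤ 1 := by linarith
    have h4 : ‖(L * α ^ 2) • g' y‖ ^ 2 ≤ (L * α) ^ 4 * ‖(x - z) + u‖ ^ 2 := by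
      rw [norm_smul, Real.norm_of_nonneg (by positivity)]
      calc (L * α ^ 2 * ‖g' y‖) ^ 2 ≤ (L * α ^ 2 * (L * ‖(x - z) + u‖)) ^ 2 := by
            gcongr; exact h1.trans (by gcongr)
        _ = _ := by ring
    -- One factor `Lα` is kept for the `x - z` part, whose bound `2V/μ` carries no `α`; for `u` the
    -- bound by `1` is enough.
    have h5 : (L * α) ^ 4 ≤ L * α := pow_le_of_le_one hLα hLα1 (by norm_num)
    calc _ ≤ (L * α) ^ 4 * (2 * (2 / μ * V) + 2 * ‖u‖ ^ 2) := h4.trans (by gcongr; linarith)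
      _ = (L * α) ^ 4 * (4 / μ * V) + (L * α) ^ 4 * (2 * ‖u‖ ^ 2) := by ring
      _ ≤ (L * α) * (4 / μ * V) + 1 * (2 * (2 * α * V)) := by
          gcongr; exact h5.trans hLα1
      _ = _ := by field_simp; ring
  have hA2 : ‖A‖ ^ 2 ≤ (24 + 8 * L / μ) * α * V := by
    have := norm_sub_sq_le_two ((y - x) + s • (x - z)) ((L * α ^ 2) • g' y)
    rw [← hA] at this
    calc _ ≤ _ := this
      _ ≤ 2 * (8 * α * V) + 2 * (4 * α * V * (1 + L / μ)) := by gcongr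
      _ = _ := by ring
  set K := 24 + 8 * L / μ with hK
  have hK0 : 0 < K := by positivity
  -- The Young weight is chosen so that the `‖A‖²` part costs at most `(s/2) V`, half of the
  -- available contraction. What remains is `Kα/(2s)` times `‖b‖²`.
  have hy1 := abs_inner_le_young (t := s / (K * α)) (by positivity) A b
  have hy2 := neg_abs_le (inner ℝ A b)
  have hy3 : s / (K * α) / 2 * ‖A‖ ^ 2 ≤ s / 2 * V := by
    calc _ ≤ s / (K * α) / 2 * (K * α * V) := by gcongr
      _ = _ := by field_simp
  have hy4 : 1 / (2 * (s / (K * α))) = (12 + 4 * L / μ) * α / s := by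
    rw [hK]; field_simp; ring
  rw [hy4] at hy1
  have hb : α / 2 * (1 + L * α) * ‖b‖ ^ 2 ≤ α * ‖b‖ ^ 2 := by
    gcongr; nlinarith
  -- The cross term `2⟪b, n⟫` joins the terms linear in `n`. This is harmless later because the bias
  -- is determined before the noise is drawn.
  have hbn : ‖b + n‖ ^ 2 = ‖b‖ ^ 2 + 2 * inner ℝ b n + ‖n‖ ^ 2 := norm_add_sq_real b n
  rw [hbn, inner_add_right] at key
  rw [inner_sub_left, inner_smul_left, conj_trivial]
  nlinarith

end CurvatureBounds

/-- The value of the Lyapunov function at equal current and previous points. -/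
theorem asgLyapunov_self {α s μ : ℝ} (hα : 0 < α) (hsq : s ^ 2 = α * μ) (g : E → ℝ) (z x : E) :
    asgLyapunov α s g z x x = μ / 2 * ‖x - z‖ ^ 2 + (g x - g z) := by
  unfold asgLyapunov
  have : (x - z) - (1 - s) • (x - z) = s • (x - z) := by module
  rw [this, norm_smul, mul_pow, Real.norm_eq_abs, sq_abs, hsq]
  field_simp

/-- The entries of `v` sum to `√(μ/2)`, so the rank-one form collapses on equal blocks. The result
agrees with `asgLyapunov_self` at `x = 0`; the two Lyapunov functions need to be matched only at the
initial point. -/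
theorem lyapunov_eq {α μ : ℝ} (g : E → ℝ) (z : E) (hμ : 0 ≤ μ) :
    lyapunov (lyapunovMatrix μ α) g z ![0 - z, 0 - z] = μ / 2 * ‖z‖ ^ 2 + (g 0 - g z) := by
  have hsq : √(μ / 2) ^ 2 = μ / 2 := Real.sq_sqrt (by positivity)
  have h2 : 1 / √(2 * α) = √(1 / (2 * α)) := by
    rw [Real.sqrt_div zero_le_one, Real.sqrt_one]
  simp only [lyapunov, lyapunovMatrix, Fin.sum_univ_two, Matrix.vecMulVec_apply,
    Matrix.cons_val_zero, Matrix.cons_val_one, zero_sub, inner_neg_neg, neg_add_cancel,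
    real_inner_self_eq_norm_sq, h2]
  linear_combination ‖z‖ ^ 2 * hsq

/-- One step of the second order recursion `c⁺ = l ((1 + β) c - β c') + r` with `0 < l < 1`. -/
theorem momentum_energy_step {l β : ℝ} (hl : 0 < l) (hl1 : l < 1) (hβ : 0 ≤ β) (hβ1 : β ≤ 1)
    (c c' cn r : E) (hcn : cn = l • ((1 + β) • c - β • c') + r) :
    (‖cn - c‖ ^ 2 + (1 / l - 1) * ‖cn‖ ^ 2) ≤
      (1 - (1 - l) / 2) * (‖c - c'‖ ^ 2 + (1 / l - 1) * ‖c‖ ^ 2)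
        + (1 + 2 / (1 / l - 1)) / l * ‖r‖ ^ 2 := by
  set κ := 1 / l - 1 with hκ
  have hκ0 : 0 < κ := by rw [hκ, sub_pos, lt_div_iff₀ hl]; linarith
  have hl' : l = 1 / (1 + κ) := by rw [hκ]; field_simp; ring
  -- Since `1 + κ = 1/l`, dividing the recursion by `l` isolates the velocity `c - c'`; the new
  -- energy, times `1 + κ`, then appears on expanding the square of the left side.
  have e : (cn - c) + κ • cn = β • (c - c') + (1 / l) • r := by
    rw [hcn, hκ, smul_add, smul_sub, smul_sub]
    simp only [sub_smul, smul_smul]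
    have : 1 / l * l = 1 := by field_simp
    match_scalars <;> field_simp <;> ring
  have h1 : ‖(cn - c) + κ • cn‖ ^ 2
      = (1 + κ) * ‖cn - c‖ ^ 2 + κ * (1 + κ) * ‖cn‖ ^ 2 - κ * ‖c‖ ^ 2 := by
    simp only [← real_inner_self_eq_norm_sq, inner_add_left, inner_add_right, inner_sub_left,
      inner_sub_right, inner_smul_left, inner_smul_right, conj_trivial, real_inner_comm c cn]
    ring
  have h2 : ‖β • (c - c') + (1 / l) • r‖ ^ 2
      ≤ (1 + κ / 2) * ‖c - c'‖ ^ 2 + (1 + 2 / κ) * ((1 / l) ^ 2 * ‖r‖ ^ 2) := by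
    rw [norm_add_sq_real, norm_smul, norm_smul, Real.norm_of_nonneg hβ,
      Real.norm_of_nonneg (by positivity), mul_pow, mul_pow]
    have y1 := abs_inner_le_young (t := κ / 2) (by positivity) (β • (c - c')) ((1 / l) • r)
    rw [norm_smul, norm_smul, Real.norm_of_nonneg hβ,
      Real.norm_of_nonneg (by positivity), mul_pow, mul_pow] at y1
    have y2 := le_abs_self (inner ℝ (β • (c - c')) ((1 / l) • r))
    have y3 : β ^ 2 * ‖c - c'‖ ^ 2 ≤ ‖c - c'‖ ^ 2 :=
      mul_le_of_le_one_left (by positivity) (by nlinarith)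
    have y4 : 1 / (2 * (κ / 2)) * ((1 / l) ^ 2 * ‖r‖ ^ 2) * 2
        = 2 / κ * ((1 / l) ^ 2 * ‖r‖ ^ 2) := by field_simp
    have y5 : κ / 2 * (β ^ 2 * ‖c - c'‖ ^ 2) ≤ κ / 2 * ‖c - c'‖ ^ 2 := by gcongr
    nlinarith
  rw [← e, h1] at h2
  -- The term `κ‖c‖²` on the right is enlarged to `(1 + κ/2)κ‖c‖²` to complete the old energy.
  -- Multiplication by `l = 1/(1 + κ)` then gives the rate `1 - (1 - l)/2`.
  have h3 : (1 + κ) * (‖cn - c‖ ^ 2 + κ * ‖cn‖ ^ 2) ≤ (1 + κ / 2) * (‖c - c'‖ ^ 2 + κ * ‖c‖ ^ 2)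
      + (1 + 2 / κ) * ((1 / l) ^ 2 * ‖r‖ ^ 2) := by
    have : 0 ≤ κ / 2 * (κ * ‖c‖ ^ 2) := by positivity
    linarith
  have h4 := mul_le_mul_of_nonneg_left h3 hl.le
  have e1 : l * (1 + κ) = 1 := by rw [hl']; field_simp
  have e2 : l * (1 + κ / 2) = 1 - (1 - l) / 2 := by linear_combination (1 / 2) * e1
  have e3 : l * ((1 + 2 / κ) * ((1 / l) ^ 2 * ‖r‖ ^ 2)) = (1 + 2 / κ) / l * ‖r‖ ^ 2 := by
    field_simp
  linear_combination h4 - (‖cn - c‖ ^ 2 + κ * ‖cn‖ ^ 2) * e1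
    + (‖c - c'‖ ^ 2 + κ * ‖c‖ ^ 2) * e2 + e3

end Deterministic

/-! ### Scalar recursions and power quotients -/

/-- A sequence with `a (k+1) ≤ q a k + c` and `0 ≤ q < 1` stays below `q^k a 0 + c / (1-q)`. -/
theorem le_of_affine_recursion {a : ℕ → ℝ} {q c : ℝ} (hq : 0 ≤ q) (hq1 : q < 1)
    (hc : 0 ≤ c) (h : ∀ k, a (k + 1) ≤ q * a k + c) (k : ℕ) :
    a k ≤ q ^ k * a 0 + c / (1 - q) := by
  have h1 : 0 < 1 - q := by linarith
  induction k with
  | zero => simp; positivity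
  | succ k ih =>
    calc a (k + 1) ≤ q * a k + c := h k
      _ ≤ q * (q ^ k * a 0 + c / (1 - q)) + c := by gcongr
      _ = _ := by field_simp; ring

theorem powerQuotient_nonneg {a b : ℝ} (ha : 0 ≤ a) (hb : 0 ≤ b) (k : ℕ) :
    0 ≤ powerQuotient a b k := by
  unfold powerQuotient
  split_ifs with h
  · positivity
  · rcases lt_or_gt_of_ne h with h | h
    · have : a ^ k ≤ b ^ k := by gcongr
      exact div_nonneg_of_nonpos (by linarith) (by linarith)
    · have : b ^ k ≤ a ^ k := by gcongr
      exact div_nonneg (by linarith) (by linarith)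
end

noncomputable section

/-! ### Orthogonality of conditionally unbiased noise -/

section Probability

variable {Ω : Type*} [MeasurableSpace Ω] {Pr : Measure Ω}

theorem integrable_inner_of_memLp_two {E : Type*} [NormedAddCommGroup E] [InnerProductSpace ℝ E]
    {a b : Ω → E} (ha : MemLp a 2 Pr) (hb : MemLp b 2 Pr) :
    Integrable (fun ω => (inner ℝ (a ω) (b ω) : ℝ)) Pr := by
  have h1 := (memLp_two_iff_integrable_sq_norm ha.1).1 ha
  have h2 := (memLp_two_iff_integrable_sq_norm hb.1).1 hb
  refine (h1.add h2).mono' (ha.1.inner hb.1) (Filter.Eventually.of_forall fun ω => ?_)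
  refine (norm_inner_le_norm (𝕜 := ℝ) _ _).trans ?_
  simp only [Pi.add_apply]
  nlinarith [sq_nonneg (‖a ω‖ - ‖b ω‖), sq_nonneg (‖a ω‖ + ‖b ω‖)]

/-- Fubini's theorem for a function of two independent random variables. -/
theorem integral_indepFun_eq {𝒳 Z F : Type*} [MeasurableSpace 𝒳] [MeasurableSpace Z]
    [NormedAddCommGroup F] [NormedSpace ℝ F] [MeasurableSpace F] [BorelSpace F]
    [SecondCountableTopology F] [IsProbabilityMeasure Pr] {X : Ω → 𝒳} {W : Ω → Z}
    (hX : Measurable X) (hW : Measurable W) (hind : IndepFun X W Pr)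
    {h : 𝒳 × Z → F} (hh : Measurable h) (hint : Integrable (fun ω => h (X ω, W ω)) Pr) :
    Integrable h ((Pr.map X).prod (Pr.map W)) ∧
    ∫ ω, h (X ω, W ω) ∂Pr = ∫ x, ∫ z, h (x, z) ∂(Pr.map W) ∂(Pr.map X) := by
  have hXW : Measurable fun ω => (X ω, W ω) := hX.prodMk hW
  have hmap := (indepFun_iff_map_prod_eq_prod_map_map hX.aemeasurable hW.aemeasurable).1 hind
  have := Measure.isProbabilityMeasure_map (μ := Pr) hX.aemeasurable
  have := Measure.isProbabilityMeasure_map (μ := Pr) hW.aemeasurable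
  have hi : Integrable h ((Pr.map X).prod (Pr.map W)) := by
    rw [← hmap]
    exact (integrable_map_measure hh.aestronglyMeasurable hXW.aemeasurable).2 hint
  refine ⟨hi, ?_⟩
  rw [← integral_prod h hi, ← hmap, integral_map hXW.aemeasurable hh.aestronglyMeasurable]

/-- If `ψ (η X) W` has zero conditional mean given `η X`, and `X`, `W` are independent, then it is
orthogonal to every square integrable function of `X`. -/
theorem integral_inner_eq_zero_of_condExp {𝒳 Z E : Type*} [MeasurableSpace 𝒳] [MeasurableSpace Z]
    [NormedAddCommGroup E] [InnerProductSpace ℝ E] [CompleteSpace E] [MeasurableSpace E]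
    [BorelSpace E] [SecondCountableTopology E] [IsProbabilityMeasure Pr] {X : Ω → 𝒳} {W : Ω → Z}
    (hX : Measurable X) (hW : Measurable W) (hind : IndepFun X W Pr)
    {η : 𝒳 → E} (hη : Measurable η) {ψ : E → Z → E} (hψ : Measurable (Function.uncurry ψ))
    (hL2 : MemLp (fun ω => ψ (η (X ω)) (W ω)) 2 Pr)
    (hzero : Pr[fun ω => ψ (η (X ω)) (W ω) |
      MeasurableSpace.comap (fun ω => η (X ω)) inferInstance] =ᵐ[Pr] 0)
    {a : 𝒳 → E} (ha : Measurable a) (haL2 : MemLp (fun ω => a (X ω)) 2 Pr) :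
    ∫ ω, inner ℝ (a (X ω)) (ψ (η (X ω)) (W ω)) ∂Pr = 0 := by
  have hηX : Measurable fun ω => η (X ω) := hη.comp hX
  have hint : Integrable (fun ω => ψ (η (X ω)) (W ω)) Pr := hL2.integrable one_le_two
  have := Measure.isProbabilityMeasure_map (μ := Pr) hX.aemeasurable
  have := Measure.isProbabilityMeasure_map (μ := Pr) hW.aemeasurable
  set Ψ : E → E := fun v => ∫ z, ψ v z ∂(Pr.map W) with hΨ
  have hψη : Measurable fun p : 𝒳 × Z => ψ (η p.1) p.2 :=
    hψ.comp ((hη.comp measurable_fst).prodMk measurable_snd)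
  obtain ⟨hψint, -⟩ := integral_indepFun_eq hX hW hind hψη hint
  have hΨint : Integrable (fun x => Ψ (η x)) (Pr.map X) := hψint.integral_prod_left
  have hΨm : StronglyMeasurable Ψ :=
    StronglyMeasurable.integral_prod_right hψ.stronglyMeasurable
  -- Unbiasedness is known only given `η X`, not given all of `X`. Independence repairs this: the
  -- average `Ψ` over `W` integrates to zero over every event `{η X ∈ s}`, hence vanishes almost
  -- surely at `η X`, and Fubini then kills the pairing with any square integrable function of `X`.
  have hΨ0 : ∀ᵐ x ∂(Pr.map X), Ψ (η x) = 0 := by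
    have hmapint : Integrable Ψ ((Pr.map X).map η) :=
      (integrable_map_measure hΨm.aestronglyMeasurable hη.aemeasurable).2 hΨint
    have h0 : Ψ =ᵐ[(Pr.map X).map η] 0 := by
      refine hmapint.ae_eq_zero_of_forall_setIntegral_eq_zero fun s hs _ => ?_
      rw [setIntegral_map hs hΨm.aestronglyMeasurable hη.aemeasurable,
        ← integral_indicator (hη hs)]
      have hm : MeasurableSet[MeasurableSpace.comap (fun ω => η (X ω)) inferInstance]
          ((fun ω => η (X ω)) ⁻¹' s) := ⟨s, hs, rfl⟩
      have h1 : ∫ ω in (fun ω => η (X ω)) ⁻¹' s, ψ (η (X ω)) (W ω) ∂Pr = 0 := by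
        rw [← setIntegral_condExp hηX.comap_le hint hm,
          integral_congr_ae (ae_restrict_of_ae hzero)]
        simp
      have hq : Measurable fun p : 𝒳 × Z => (η ⁻¹' s).indicator (fun x => ψ (η x) p.2) p.1 := by
        have : (fun p : 𝒳 × Z => (η ⁻¹' s).indicator (fun x => ψ (η x) p.2) p.1)
            = (Prod.fst ⁻¹' (η ⁻¹' s)).indicator (fun p : 𝒳 × Z => ψ (η p.1) p.2) := by
          ext p; rfl
        rw [this]
        exact hψη.indicator (measurable_fst (hη hs))
      have hqe : (fun ω => (η ⁻¹' s).indicator (fun x => ψ (η x) (W ω)) (X ω))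
          = ((fun ω => η (X ω)) ⁻¹' s).indicator fun ω => ψ (η (X ω)) (W ω) := by
        ext ω; rfl
      obtain ⟨-, h2⟩ := integral_indepFun_eq hX hW hind hq
        (by simp only [hqe]; exact hint.indicator (hηX hs))
      simp only [hqe] at h2
      rw [integral_indicator (hηX hs), h1] at h2
      rw [h2]
      refine integral_congr_ae (Filter.Eventually.of_forall fun x => ?_)
      by_cases hx : x ∈ η ⁻¹' s
      · simp [hx, Set.indicator, hΨ]
      · simp [hx, Set.indicator]
    exact ae_of_ae_map hη.aemeasurable h0
  have ham : Measurable fun p : 𝒳 × Z => (inner ℝ (a p.1) (ψ (η p.1) p.2) : ℝ) :=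
    (ha.comp measurable_fst).inner hψη
  obtain ⟨-, h3⟩ := integral_indepFun_eq hX hW hind ham
    (integrable_inner_of_memLp_two haL2 hL2)
  refine h3.trans ?_
  refine (integral_congr_ae (?_ : _ =ᵐ[Pr.map X] fun _ => (0 : ℝ))).trans (by simp)
  filter_upwards [hψint.prod_right_ae, hΨ0] with x hx hx0
  rw [integral_inner hx]
  change inner ℝ (a x) (Ψ (η x)) = 0
  rw [hx0, inner_zero_right]

/-- A member of an independent family is independent of the tuple of all the others. -/
theorem iIndepFun.indepFun_rest {ι Z : Type*} [MeasurableSpace Z] {w : ι → Ω → Z}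
    (hw : ∀ q, Measurable (w q)) (h : iIndepFun w Pr) (p : ι) :
    IndepFun (fun ω (q : {q // q ≠ p}) => w q ω) (w p) Pr := by
  have h1 := indep_iSup_of_disjoint (m := fun q => MeasurableSpace.comap (w q) inferInstance)
    (fun q => (hw q).comap_le) h.iIndep (S := {q | q ≠ p}) (T := {p})
    (by rw [Set.disjoint_left]; intro q hq; exact hq)
  rw [IndepFun_iff_Indep]
  refine indep_of_indep_of_le h1 ?_ ?_
  · rw [MeasurableSpace.pi, MeasurableSpace.comap_iSup]
    refine iSup_le fun q => ?_
    rw [MeasurableSpace.comap_comp]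
    exact le_iSup₂_of_le q.1 q.2 le_rfl
  · simp

end Probability
end

noncomputable section

/-! ### Spectral properties of the weight matrix -/

theorem Stack.inner_eq_sum {N d : ℕ} (x y : Stack N d) :
    (inner ℝ x y : ℝ) = ∑ i, inner ℝ (x i) (y i) := PiLp.inner_apply x y

theorem Stack.norm_sq_eq_sum {N d : ℕ} (x : Stack N d) : ‖x‖ ^ 2 = ∑ i, ‖x i‖ ^ 2 :=
  PiLp.norm_sq_eq_of_L2 _ x

namespace DecentralizedProblem

variable {N d : ℕ} (P : DecentralizedProblem N d)

section Spectral

theorem W_comm (i j : Fin N) : P.W i j = P.W j i := P.weight.symm.apply j i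

theorem W_nonneg (i j : Fin N) : 0 ≤ P.W i j := by
  by_cases hij : i = j
  · exact hij ▸ (P.weight.diag_pos i).le
  · by_cases ha : P.graph.Adj i j
    · exact (P.weight.edge_pos i j ha).le
    · exact (P.weight.nonedge i j hij ha).ge

theorem W_col_sum (j : Fin N) : ∑ i, P.W i j = 1 := by
  simp_rw [P.W_comm _ j]; exact P.weight.row_sum j

/-- The Dirichlet form of the network. -/
theorem sum_inner_sub_mix {E : Type*} [NormedAddCommGroup E] [InnerProductSpace ℝ E]
    (x : Fin N → E) :
    ∑ i, inner ℝ (x i) (x i - ∑ j, P.W i j • x j)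
      = 1 / 2 * ∑ i, ∑ j, P.W i j * ‖x i - x j‖ ^ 2 := by
  have h1 : ∀ i, ∑ j, P.W i j * ‖x i - x j‖ ^ 2
      = ‖x i‖ ^ 2 - 2 * ∑ j, P.W i j * inner ℝ (x i) (x j) + ∑ j, P.W i j * ‖x j‖ ^ 2 := by
    intro i
    simp_rw [norm_sub_sq_real, mul_add, mul_sub, Finset.sum_add_distrib, Finset.sum_sub_distrib,
      ← Finset.sum_mul, P.weight.row_sum, Finset.mul_sum]
    rw [one_mul]
    congr 2
    exact Finset.sum_congr rfl fun j _ => by ring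
  have h2 : ∑ i, ∑ j, P.W i j * ‖x j‖ ^ 2 = ∑ i, ‖x i‖ ^ 2 := by
    rw [Finset.sum_comm]
    simp_rw [← Finset.sum_mul, P.W_col_sum, one_mul]
  simp_rw [h1, Finset.sum_add_distrib, Finset.sum_sub_distrib, h2, ← Finset.mul_sum, inner_sub_right,
    inner_sum, inner_smul_right, Finset.sum_sub_distrib, real_inner_self_eq_norm_sq]
  ring

/-- The `k`-th eigenvalue of `W`, in the indexing of the eigenvector basis. -/
def eig (k : Fin N) : ℝ := P.isHermitian_W.eigenvalues k

/-- The `i`-th coordinate of the `k`-th vector of an orthonormal eigenbasis of `W`. -/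
def eigvec (k i : Fin N) : ℝ := P.isHermitian_W.eigenvectorBasis k i

theorem sum_W_mul_eigvec (k i : Fin N) : ∑ j, P.W i j * P.eigvec k j = P.eig k * P.eigvec k i := by
  have := congrFun (P.isHermitian_W.mulVec_eigenvectorBasis k) i
  simpa [Matrix.mulVec, dotProduct, eig, eigvec] using this

theorem sum_eigvec_mul_eigvec (k l : Fin N) :
    ∑ i, P.eigvec k i * P.eigvec l i = if k = l then 1 else 0 := by
  have := orthonormal_iff_ite.1 P.isHermitian_W.eigenvectorBasis.orthonormal l k
  rw [PiLp.inner_apply] at this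
  simp only [eq_comm (a := k)]
  simpa [eigvec] using this

/-- The square matrix of eigenvectors has orthonormal rows, hence orthonormal columns. -/
theorem sum_eigvec_mul_eigvec' (i j : Fin N) :
    ∑ k, P.eigvec k i * P.eigvec k j = if i = j then 1 else 0 := by
  have h : (Matrix.of P.eigvec) * (Matrix.of P.eigvec).transpose = 1 := by
    ext k l
    simp [Matrix.mul_apply, Matrix.one_apply, P.sum_eigvec_mul_eigvec]
  have h2 := mul_eq_one_comm.1 h
  have h' := congrFun (congrFun h2 i) j
  simpa [Matrix.mul_apply, Matrix.one_apply] using h'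

theorem sum_eigvec_sq (k : Fin N) : ∑ i, P.eigvec k i ^ 2 = 1 := by
  simpa [pow_two] using P.sum_eigvec_mul_eigvec k k

theorem one_sub_eig (k : Fin N) :
    1 - P.eig k = 1 / 2 * ∑ i, ∑ j, P.W i j * (P.eigvec k i - P.eigvec k j) ^ 2 := by
  have h := P.sum_inner_sub_mix (E := ℝ) (P.eigvec k)
  simp only [smul_eq_mul, P.sum_W_mul_eigvec, Real.norm_eq_abs, sq_abs] at h
  rw [← h]
  have : ∀ i, (inner ℝ (P.eigvec k i) (P.eigvec k i - P.eig k * P.eigvec k i) : ℝ)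
      = (1 - P.eig k) * P.eigvec k i ^ 2 := fun i => by
    simp only [RCLike.inner_apply, conj_trivial]; ring
  simp_rw [this, ← Finset.mul_sum, P.sum_eigvec_sq, mul_one]

theorem eig_le_one (k : Fin N) : P.eig k ≤ 1 := by
  have h := P.one_sub_eig k
  have : 0 ≤ ∑ i, ∑ j, P.W i j * (P.eigvec k i - P.eigvec k j) ^ 2 :=
    Finset.sum_nonneg fun i _ => Finset.sum_nonneg fun j _ =>
      mul_nonneg (P.W_nonneg i j) (sq_nonneg _)
  linarith

/-- The Dirichlet form vanishes on such an eigenvector. All its terms are nonnegative and edges have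
positive weight, so values agree across edges and then along walks. -/
theorem eigvec_const_of_eig_eq_one {k : Fin N} (hk : P.eig k = 1) (i j : Fin N) :
    P.eigvec k i = P.eigvec k j := by
  have h := P.one_sub_eig k
  have hn : ∀ i j, 0 ≤ P.W i j * (P.eigvec k i - P.eigvec k j) ^ 2 := fun i j =>
    mul_nonneg (P.W_nonneg i j) (sq_nonneg _)
  have h0 : ∑ i, ∑ j, P.W i j * (P.eigvec k i - P.eigvec k j) ^ 2 = 0 := by linarith
  have hadj : ∀ i j, P.graph.Adj i j → P.eigvec k i = P.eigvec k j := by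
    intro i j hij
    have h1 := (Finset.sum_eq_zero_iff_of_nonneg
      (fun i _ => Finset.sum_nonneg fun j _ => hn i j)).1 h0 i (Finset.mem_univ _)
    have h2 := (Finset.sum_eq_zero_iff_of_nonneg (fun j _ => hn i j)).1 h1 j (Finset.mem_univ _)
    rcases mul_eq_zero.1 h2 with h3 | h3
    · exact absurd h3 (P.weight.edge_pos i j hij).ne'
    · exact sub_eq_zero.1 (pow_eq_zero_iff two_ne_zero |>.1 h3)
  obtain ⟨p⟩ := P.connected.preconnected i j
  induction p with
  | nil => rfl
  | cons hij _ ih => exact (hadj _ _ hij).trans ih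

theorem exists_eig_eq_eigenvalue (j : Fin N) :
    P.eig ((Fintype.equivOfCardEq (Fintype.card_fin _)) (Fin.cast (Fintype.card_fin N).symm j))
      = P.eigenvalue j := by
  simp [eig, eigenvalue, Matrix.IsHermitian.eigenvalues]

/-- `eigenvalues` is a reindexing of the decreasing sequence `eigenvalues₀`, so it is enough that no
position exceeds `N - 1`. -/
theorem lambdaMin_le_eig (k : Fin N) : P.lambdaMin ≤ P.eig k := by
  unfold lambdaMin eigenvalue eig Matrix.IsHermitian.eigenvalues
  apply P.isHermitian_W.eigenvalues₀_antitone
  set q := (Fintype.equivOfCardEq (Fintype.card_fin _)).symm k with hq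
  have := q.2
  rw [Fin.le_def]
  simp only [Fintype.card_fin, Fin.val_cast] at this ⊢
  omega

theorem lambdaMin_le_lambdaTwo : P.lambdaMin ≤ P.lambdaTwo := by
  unfold lambdaTwo
  rw [← P.exists_eig_eq_eigenvalue]
  exact P.lambdaMin_le_eig _

/-- Otherwise two orthonormal eigenvectors would belong to the eigenvalue `1`. Both would be
constant over the nodes, and nonzero constant vectors are not orthogonal. -/
theorem lambdaTwo_lt_one : P.lambdaTwo < 1 := by
  have hN := P.two_le
  unfold lambdaTwo
  set e : Fin N → Fin N := fun j =>
    (Fintype.equivOfCardEq (Fintype.card_fin _)) (Fin.cast (Fintype.card_fin N).symm j) with he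
  have he' : ∀ j, P.eig (e j) = P.eigenvalue j := P.exists_eig_eq_eigenvalue
  have hinj : Function.Injective e := (Equiv.injective _).comp (Fin.cast_injective _)
  have h2 : P.eigenvalue ⟨1, P.two_le⟩ ≤ 1 := he' ⟨1, P.two_le⟩ ▸ P.eig_le_one _
  refine lt_of_le_of_ne h2 fun h => ?_
  have h01 : P.eigenvalue ⟨1, P.two_le⟩ ≤ P.eigenvalue ⟨0, by omega⟩ := by
    apply P.isHermitian_W.eigenvalues₀_antitone
    simp [Fin.le_def]
  have h0 : P.eigenvalue ⟨0, by omega⟩ ≤ 1 := he' ⟨0, by omega⟩ ▸ P.eig_le_one _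
  set k := e ⟨1, P.two_le⟩ with hk
  set l := e ⟨0, by omega⟩ with hl
  have hkl : k ≠ l := fun hc => by
    have := hinj hc
    simp at this
  have ck := P.eigvec_const_of_eig_eq_one (k := k) (by rw [hk, he', h])
  have cl := P.eigvec_const_of_eig_eq_one (k := l) (by rw [hl, he']; linarith)
  have hs := P.sum_eigvec_mul_eigvec k l
  have hkk := P.sum_eigvec_sq k
  have hll := P.sum_eigvec_sq l
  set z : Fin N := ⟨0, by omega⟩
  rw [if_neg hkl, Finset.sum_congr rfl (fun i _ => by rw [ck i z, cl i z])] at hs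
  rw [Finset.sum_congr rfl (fun i _ => by rw [ck i z])] at hkk
  rw [Finset.sum_congr rfl (fun i _ => by rw [cl i z])] at hll
  simp only [Finset.sum_const, Finset.card_univ, Fintype.card_fin, nsmul_eq_mul] at hs hkk hll
  have hN0 : (N : ℝ) ≠ 0 := by positivity
  rcases mul_eq_zero.1 hs with h3 | h3
  · exact hN0 h3
  · rcases mul_eq_zero.1 h3 with h4 | h4
    · rw [h4] at hkk; norm_num at hkk
    · rw [h4] at hll; norm_num at hll

theorem gamma_pos (hlam : 0 < P.lambdaMin) : 0 < P.gamma :=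
  lt_max_of_lt_right (abs_pos.2 hlam.ne')

theorem gamma_lt_one (hlam : 0 < P.lambdaMin) : P.gamma < 1 := by
  have h1 := P.lambdaMin_le_lambdaTwo
  have h2 := P.lambdaTwo_lt_one
  unfold gamma
  rw [abs_of_pos hlam, abs_of_pos (hlam.trans_le h1), max_eq_left h1]
  exact h2

theorem lambdaMin_le_one : P.lambdaMin ≤ 1 :=
  P.lambdaMin_le_lambdaTwo.trans P.lambdaTwo_lt_one.le

/-- The component of `x` along the `k`-th eigenvector of `W`. -/
def component {E : Type*} [AddCommGroup E] [Module ℝ E] (k : Fin N) (x : Fin N → E) : E :=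
  ∑ i, P.eigvec k i • x i

theorem sum_eigvec_smul_component {E : Type*} [AddCommGroup E] [Module ℝ E] (x : Fin N → E)
    (i : Fin N) : ∑ k, P.eigvec k i • P.component k x = x i := by
  simp_rw [component, Finset.smul_sum, smul_smul]
  rw [Finset.sum_comm]
  simp_rw [← Finset.sum_smul, P.sum_eigvec_mul_eigvec', ite_smul, one_smul, zero_smul]
  simp

theorem component_mix {E : Type*} [AddCommGroup E] [Module ℝ E] (k : Fin N) (x : Fin N → E) :
    P.component k (fun i => ∑ j, P.W i j • x j) = P.eig k • P.component k x := by
  simp_rw [component, Finset.smul_sum, smul_smul]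
  rw [Finset.sum_comm]
  refine Finset.sum_congr rfl fun j _ => ?_
  rw [← P.sum_W_mul_eigvec, ← Finset.sum_smul]
  congr 1
  exact Finset.sum_congr rfl fun i _ => by rw [P.W_comm i j, mul_comm]

theorem sum_inner_eq_sum_inner_component {E : Type*} [NormedAddCommGroup E]
    [InnerProductSpace ℝ E] (x y : Fin N → E) :
    ∑ i, (inner ℝ (x i) (y i) : ℝ) = ∑ k, inner ℝ (P.component k x) (P.component k y) := by
  calc ∑ i, (inner ℝ (x i) (y i) : ℝ)
      = ∑ i, inner ℝ (x i) (∑ k, P.eigvec k i • P.component k y) := by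
        simp_rw [P.sum_eigvec_smul_component]
    _ = ∑ k, ∑ i, P.eigvec k i * inner ℝ (x i) (P.component k y) := by
        simp_rw [inner_sum, inner_smul_right]; exact Finset.sum_comm
    _ = _ := by
        refine Finset.sum_congr rfl fun k _ => ?_
        conv_rhs => rw [component, sum_inner]
        simp_rw [inner_smul_left, conj_trivial]

theorem sum_norm_sq_component {E : Type*} [NormedAddCommGroup E]
    [InnerProductSpace ℝ E] (x : Fin N → E) :
    ∑ k, ‖P.component k x‖ ^ 2 = ∑ i, ‖x i‖ ^ 2 := by
  simpa [real_inner_self_eq_norm_sq] using (P.sum_inner_eq_sum_inner_component x x).symm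

theorem norm_sq_component_le {E : Type*} [NormedAddCommGroup E]
    [InnerProductSpace ℝ E] (k : Fin N) (x : Fin N → E) :
    ‖P.component k x‖ ^ 2 ≤ ∑ i, ‖x i‖ ^ 2 := by
  rw [← P.sum_norm_sq_component]
  exact Finset.single_le_sum (f := fun k => ‖P.component k x‖ ^ 2) (fun _ _ => by positivity)
    (Finset.mem_univ k)

/-- The disagreement of the nodes is carried by the components with eigenvalue below `1`. -/
theorem sum_norm_sub_average_sq (x : Stack N d) :
    ∑ i, ‖x i - nodeAverage x‖ ^ 2
      = ∑ k, if P.eig k = 1 then 0 else ‖P.component k x‖ ^ 2 := by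
  have hN : (N : ℝ) ≠ 0 := by
    have := P.two_le; positivity
  rw [← P.sum_norm_sq_component]
  refine Finset.sum_congr rfl fun k _ => ?_
  split_ifs with hk
  · have hc := P.eigvec_const_of_eig_eq_one hk ⟨0, by have := P.two_le; omega⟩
    have : P.component k (fun i => x i - nodeAverage x) = 0 := by
      rw [component, Finset.sum_congr rfl (fun i _ => by rw [← hc i]), ← Finset.smul_sum,
        Finset.sum_sub_distrib, nodeAverage, Finset.sum_const, Finset.card_univ, Fintype.card_fin,
        ← Nat.cast_smul_eq_nsmul ℝ, smul_smul, mul_inv_cancel₀ hN, one_smul, sub_self, smul_zero]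
    rw [this]; simp
  -- Column sums equal to one give `(eig k - 1) ∑ i, eigvec k i = 0`, so subtracting the average
  -- does not change this component.
  · have h0 : ∑ i, P.eigvec k i = 0 := by
      have h1 : ∑ i, ∑ j, P.W i j * P.eigvec k j = ∑ j, P.eigvec k j := by
        rw [Finset.sum_comm]
        simp_rw [← Finset.sum_mul, P.W_col_sum, one_mul]
      simp_rw [P.sum_W_mul_eigvec, ← Finset.mul_sum] at h1
      have h2 : (P.eig k - 1) * ∑ i, P.eigvec k i = 0 := by rw [sub_mul, h1]; ring
      exact (mul_eq_zero.1 h2).resolve_left (sub_ne_zero.2 hk)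
    congr 2
    simp_rw [component, smul_sub, Finset.sum_sub_distrib, ← Finset.sum_smul, h0, zero_smul,
      sub_zero]

end Spectral

/-! ### Mixing and gradients of the stacked objectives -/

@[simp] theorem mix_apply (x : Stack N d) (i : Fin N) : P.mix x i = ∑ j, P.W i j • x j := rfl

theorem mix_sub (x y : Stack N d) : P.mix (x - y) = P.mix x - P.mix y := by
  ext i : 1
  simp [smul_sub, Finset.sum_sub_distrib]

theorem inner_mix_comm (x y : Stack N d) :
    (inner ℝ (P.mix x) y : ℝ) = inner ℝ x (P.mix y) := by
  simp only [Stack.inner_eq_sum, mix_apply, sum_inner, inner_sum, inner_smul_left,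
    inner_smul_right, conj_trivial]
  rw [Finset.sum_comm]
  exact Finset.sum_congr rfl fun i _ => Finset.sum_congr rfl fun j _ => by rw [P.W_comm]

theorem inner_sub_mix_nonneg (x : Stack N d) : 0 ≤ (inner ℝ x (x - P.mix x) : ℝ) := by
  rw [Stack.inner_eq_sum]
  simp only [PiLp.sub_apply, mix_apply]
  rw [P.sum_inner_sub_mix]
  exact mul_nonneg (by norm_num) (Finset.sum_nonneg fun i _ => Finset.sum_nonneg fun j _ =>
      mul_nonneg (P.W_nonneg i j) (sq_nonneg _))

theorem inner_sub_mix_le (x : Stack N d) :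
    (inner ℝ x (x - P.mix x) : ℝ) ≤ (1 - P.lambdaMin) * ‖x‖ ^ 2 := by
  rw [inner_sub_right, real_inner_self_eq_norm_sq, sub_mul, one_mul]
  refine sub_le_sub_left ?_ _
  rw [Stack.inner_eq_sum, Stack.norm_sq_eq_sum]
  simp only [mix_apply]
  rw [P.sum_inner_eq_sum_inner_component, ← P.sum_norm_sq_component, Finset.mul_sum]
  refine Finset.sum_le_sum fun k _ => ?_
  rw [P.component_mix, inner_smul_right, real_inner_self_eq_norm_sq]
  exact mul_le_mul_of_nonneg_right (P.lambdaMin_le_eig k) (by positivity)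

/-- The stack of the local gradients. -/
def localGradients (x : Stack N d) : Stack N d := WithLp.toLp 2 fun i => gradient (P.f i) (x i)

@[simp] theorem localGradients_apply (x : Stack N d) (i : Fin N) :
    P.localGradients x i = gradient (P.f i) (x i) := rfl

theorem gradient_F (x : Stack N d) : gradient P.F x = P.localGradients x := by
  refine HasGradientAt.gradient ?_
  rw [hasGradientAt_iff_hasFDerivAt]
  have h : ∀ i, HasFDerivAt (fun x : Stack N d => P.f i (x i))
      ((InnerProductSpace.toDual ℝ (Vec d) (gradient (P.f i) (x i))).comp
        (PiLp.proj 2 (fun _ : Fin N => Vec d) i : Stack N d →L[ℝ] Vec d)) x := by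
    intro i
    have h1 := ((P.local_class i).differentiable (x i)).hasGradientAt.hasFDerivAt
    exact h1.comp x (PiLp.proj 2 (fun _ : Fin N => Vec d) i : Stack N d →L[ℝ] Vec d).hasFDerivAt
  have h2 := HasFDerivAt.fun_sum (u := Finset.univ) fun i _ => h i
  refine h2.congr_fderiv ?_
  ext v
  simp [Stack.inner_eq_sum]

theorem curvatureBounds_local (i : Fin N) :
    CurvatureBounds P.μ P.L (P.f i) (gradient (P.f i)) :=
  ⟨(P.local_class i).upper, (P.local_class i).lower⟩

theorem curvatureBounds_objective :
    CurvatureBounds P.μ P.L P.objective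
      (fun x => (N : ℝ)⁻¹ • ∑ i, gradient (P.f i) x) := by
  have hN : (N : ℝ) ≠ 0 := by
    have := P.two_le; positivity
  have key : ∀ x y, P.objective x - P.objective y
      - inner ℝ ((N : ℝ)⁻¹ • ∑ i, gradient (P.f i) y) (x - y)
      = (N : ℝ)⁻¹ * ∑ i, (P.f i x - P.f i y - inner ℝ (gradient (P.f i) y) (x - y)) := by
    intro x y
    simp only [objective, inner_smul_left, sum_inner, conj_trivial, Finset.sum_sub_distrib]
    ring
  have hc : ∀ c : ℝ, (N : ℝ)⁻¹ * ∑ _i : Fin N, c = c := fun c => by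
    simp [hN]
  refine ⟨fun x y => ?_, fun x y => ?_⟩
  · rw [key, ← hc (P.L / 2 * _)]
    gcongr with i
    exact (P.local_class i).upper x y
  · rw [key, ← hc (P.μ / 2 * _)]
    gcongr with i
    exact (P.local_class i).lower x y

/-- The gradient of the penalized objective. -/
def penalizedGradient (α : ℝ) (x : Stack N d) : Stack N d :=
  (1 / α) • (x - P.mix x) + P.localGradients x

/-- For a quadratic form the first-order remainder is the form itself at `x - y`, here between `0`
and `(1 - λ_N)/(2α) ‖x - y‖²`; the curvature bounds of `F` are added node by node. -/
theorem curvatureBounds_penalized {α : ℝ} (hα : 0 < α) :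
    CurvatureBounds P.μ ((1 - P.lambdaMin) / α + P.L) (P.penalized α)
      (P.penalizedGradient α) := by
  have key : ∀ x y : Stack N d, P.penalized α x - P.penalized α y
      - inner ℝ (P.penalizedGradient α y) (x - y)
      = 1 / (2 * α) * inner ℝ (x - y) ((x - y) - P.mix (x - y))
        + ∑ i, (P.f i (x i) - P.f i (y i) - inner ℝ (gradient (P.f i) (y i)) (x i - y i)) := by
    intro x y
    have e1 : (inner ℝ (P.localGradients y) (x - y) : ℝ)
        = ∑ i, inner ℝ (gradient (P.f i) (y i)) (x i - y i) := by
      rw [Stack.inner_eq_sum]; rfl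
    have e2 := P.inner_mix_comm x y
    have e3 : (inner ℝ (P.mix y) x : ℝ) = inner ℝ (P.mix x) y := by
      rw [P.inner_mix_comm y x, real_inner_comm]
    simp only [penalized, penalizedGradient, F, inner_add_left, inner_smul_left, conj_trivial, e1,
      P.mix_sub, Finset.sum_sub_distrib]
    simp only [inner_sub_left, inner_sub_right]
    rw [real_inner_comm x y, ← e2, real_inner_comm (P.mix x) y, P.inner_mix_comm y y, e3]
    field_simp
    ring
  have hsum : ∀ (c : ℝ) (x y : Stack N d), c * ‖x - y‖ ^ 2 = ∑ i, c * ‖x i - y i‖ ^ 2 := by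
    intro c x y
    rw [Stack.norm_sq_eq_sum, Finset.mul_sum]; rfl
  refine ⟨fun x y => ?_, fun x y => ?_⟩
  · rw [key]
    have h1 := P.inner_sub_mix_le (x - y)
    have h2 : ∑ i, (P.f i (x i) - P.f i (y i) - inner ℝ (gradient (P.f i) (y i)) (x i - y i))
        ≤ P.L / 2 * ‖x - y‖ ^ 2 := by
      rw [hsum]
      exact Finset.sum_le_sum fun i _ => (P.local_class i).upper _ _
    calc _ ≤ 1 / (2 * α) * ((1 - P.lambdaMin) * ‖x - y‖ ^ 2) + P.L / 2 * ‖x - y‖ ^ 2 := by gcongr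
      _ = _ := by field_simp
  · rw [key]
    have h1 : 0 ≤ 1 / (2 * α) * (inner ℝ (x - y) ((x - y) - P.mix (x - y)) : ℝ) :=
      mul_nonneg (by positivity) (P.inner_sub_mix_nonneg (x - y))
    have h2 : P.μ / 2 * ‖x - y‖ ^ 2 ≤
        ∑ i, (P.f i (x i) - P.f i (y i) - inner ℝ (gradient (P.f i) (y i)) (x i - y i)) := by
      rw [hsum]
      exact Finset.sum_le_sum fun i _ => (P.local_class i).lower _ _
    linarith

theorem penalizedGradient_eq_zero {α : ℝ} (hα : 0 < α) {x : Stack N d}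
    (hx : P.IsFixedPoint α x) : P.penalizedGradient α x = 0 := by
  have h : α • P.penalizedGradient α x = 0 := by
    rw [penalizedGradient, smul_add, smul_smul, mul_one_div_cancel hα.ne', one_smul,
      ← P.gradient_F]
    exact hx
  exact (smul_eq_zero.1 h).resolve_left hα.ne'

/-- A bound for `F(0) - min F`. -/
def initialGap : ℝ := ∑ i, 1 / (2 * P.μ) * ‖gradient (P.f i) 0‖ ^ 2

theorem initialGap_nonneg : 0 ≤ P.initialGap :=
  Finset.sum_nonneg fun i _ => by have := P.mu_pos; positivity

/-- The penalty vanishes at `0` and is nonnegative elsewhere, so only `F` matters. The bound is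
therefore free of `α`. -/
theorem penalized_sub_le_initialGap {α : ℝ} (hα : 0 < α) (x : Stack N d) :
    P.penalized α 0 - P.penalized α x ≤ P.initialGap := by
  have h1 : 0 ≤ 1 / (2 * α) * (inner ℝ x (x - P.mix x) : ℝ) :=
    mul_nonneg (by positivity) (P.inner_sub_mix_nonneg x)
  have h2 : P.F 0 - P.F x ≤ P.initialGap := by
    rw [F, F, ← Finset.sum_sub_distrib]
    exact Finset.sum_le_sum fun i _ => (P.curvatureBounds_local i).sub_le_of_gradient P.mu_pos _ _
  simp only [penalized, inner_zero_left, mul_zero]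
  linarith

end DecentralizedProblem
end

noncomputable section

namespace DecentralizedProblem

variable {N d : ℕ} (P : DecentralizedProblem N d)

/-! ### Trajectories as functions of the random inputs -/

section Trajectory

variable {Z : Type*} (α : ℝ) (G : Fin N → Vec d → Z → Vec d)

/-- The iterate `x^{(k)}` along the inputs `w`. -/
def iterate (k : ℕ) (w : ℕ → Fin N → Z) : Stack N d := dasgX P.W α (P.beta α) G 0 0 w k

/-- The iterate `x^{(k-1)}` along the inputs `w`. -/
def prevIterate (k : ℕ) (w : ℕ → Fin N → Z) : Stack N d :=
  (dasgPair P.W α (P.beta α) G 0 0 w k).2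

/-- The query point `y^{(k)}` along the inputs `w`. -/
def query (k : ℕ) (w : ℕ → Fin N → Z) : Stack N d := dasgY P.W α (P.beta α) G 0 0 w k

/-- The gradient noise at step `k` along the inputs `w`. -/
def noise (k : ℕ) (w : ℕ → Fin N → Z) : Stack N d := WithLp.toLp 2 fun i =>
  G i (P.query α G k w i) (w k i) - gradient (P.f i) (P.query α G k w i)

variable {w w' : ℕ → Fin N → Z}

theorem noise_apply (k : ℕ) (i : Fin N) : P.noise α G k w i =
    G i (P.query α G k w i) (w k i) - gradient (P.f i) (P.query α G k w i) := rfl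

@[simp] theorem iterate_zero : P.iterate α G 0 w = 0 := rfl

@[simp] theorem prevIterate_zero : P.prevIterate α G 0 w = 0 := rfl

theorem prevIterate_succ (k : ℕ) : P.prevIterate α G (k + 1) w = P.iterate α G k w := rfl

theorem query_eq (k : ℕ) : P.query α G k w
    = (1 + P.beta α) • P.iterate α G k w - P.beta α • P.prevIterate α G k w := rfl

theorem iterate_succ (k : ℕ) : P.iterate α G (k + 1) w
    = P.mix (P.query α G k w)
      - α • (P.localGradients (P.query α G k w) + P.noise α G k w) := by
  ext i : 1
  simp only [PiLp.sub_apply, PiLp.smul_apply, PiLp.add_apply, noise_apply, localGradients_apply,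
    mix_apply, add_sub_cancel]
  rfl

/-- The mixing step is itself a gradient step of length `α` on the penalty, so D-ASG is accelerated
gradient descent on the penalized objective. -/
theorem iterate_succ_eq_penalized {α : ℝ} (hα : 0 < α) (k : ℕ) : P.iterate α G (k + 1) w
    = P.query α G k w
      - α • (P.penalizedGradient α (P.query α G k w) + P.noise α G k w) := by
  rw [iterate_succ, penalizedGradient]
  simp only [smul_add, smul_smul, mul_one_div_cancel hα.ne', one_smul]
  abel

/-- The state at step `k` uses only inputs of times `t < k`. This makes the query point at step `k`
independent of the inputs drawn at that step. -/
theorem dasgPair_congr (k : ℕ) (h : ∀ t < k, w t = w' t) :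
    dasgPair P.W α (P.beta α) G 0 0 w k = dasgPair P.W α (P.beta α) G 0 0 w' k := by
  induction k with
  | zero => rfl
  | succ k ih =>
    have := ih fun t ht => h t (ht.trans k.lt_succ_self)
    simp only [dasgPair, this, h k k.lt_succ_self]

theorem iterate_congr (k : ℕ) (h : ∀ t < k, w t = w' t) :
    P.iterate α G k w = P.iterate α G k w' :=
  congrArg Prod.fst (P.dasgPair_congr α G k h)

theorem prevIterate_congr (k : ℕ) (h : ∀ t < k, w t = w' t) :
    P.prevIterate α G k w = P.prevIterate α G k w' :=
  congrArg Prod.snd (P.dasgPair_congr α G k h)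

theorem query_congr (k : ℕ) (h : ∀ t < k, w t = w' t) :
    P.query α G k w = P.query α G k w' := by
  rw [query_eq, query_eq, P.iterate_congr α G k h, P.prevIterate_congr α G k h]

end Trajectory

section Continuity

theorem continuous_localGradients (hL : 0 < P.L) : Continuous P.localGradients := by
  refine (PiLp.continuous_toLp 2 _).comp (continuous_pi fun i => ?_)
  exact ((P.curvatureBounds_local i).continuous_gradient P.mu_pos.le hL).comp
    (PiLp.continuous_apply 2 _ i)

theorem continuous_mix : Continuous P.mix := by
  refine (PiLp.continuous_toLp 2 _).comp (continuous_pi fun i => ?_)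
  fun_prop

theorem norm_localGradients_sub_le (hL : 0 < P.L) (x y : Stack N d) :
    ‖P.localGradients x - P.localGradients y‖ ≤ P.L * ‖x - y‖ := by
  refine le_of_sq_le_sq ?_ (by positivity)
  rw [mul_pow, Stack.norm_sq_eq_sum, Stack.norm_sq_eq_sum, Finset.mul_sum]
  refine Finset.sum_le_sum fun i _ => ?_
  rw [← mul_pow]
  have := (P.curvatureBounds_local i).lipschitz P.mu_pos.le hL (x i) (y i)
  exact pow_le_pow_left₀ (norm_nonneg _) this 2

theorem continuous_nodeAverage : Continuous (nodeAverage (N := N) (d := d)) := by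
  unfold nodeAverage
  fun_prop

end Continuity

section Measurability

variable {Z : Type*} [MeasurableSpace Z] (α : ℝ) {G : Fin N → Vec d → Z → Vec d}

theorem measurable_dasgPair (hG : ∀ i, Measurable (Function.uncurry (G i))) (k : ℕ) :
    Measurable fun w : ℕ → Fin N → Z => dasgPair P.W α (P.beta α) G 0 0 w k := by
  induction k with
  | zero => exact measurable_const
  | succ k ih =>
    have h1 := ih.fst
    have h2 := ih.snd
    have hy : Measurable fun w : ℕ → Fin N → Z => P.query α G k w :=
      (h1.const_smul (1 + P.beta α)).sub (h2.const_smul (P.beta α))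
    have hyi : ∀ i, Measurable fun w : ℕ → Fin N → Z => P.query α G k w i := fun i =>
      (PiLp.continuous_apply 2 _ i).measurable.comp hy
    have hwi : ∀ i, Measurable fun w : ℕ → Fin N → Z => w k i := fun i => by fun_prop
    refine Measurable.prodMk ?_ h1
    refine (WithLp.measurable_toLp 2 _).comp (measurable_pi_lambda _ fun i => ?_)
    refine (Finset.measurable_sum _ fun j _ => (hyi j).const_smul (P.W i j)).sub ?_
    exact ((hG i).comp ((hyi i).prodMk (hwi i))).const_smul α

theorem measurable_iterate (hG : ∀ i, Measurable (Function.uncurry (G i))) (k : ℕ) :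
    Measurable (P.iterate α G k) := (P.measurable_dasgPair α hG k).fst

theorem measurable_prevIterate (hG : ∀ i, Measurable (Function.uncurry (G i))) (k : ℕ) :
    Measurable (P.prevIterate α G k) := (P.measurable_dasgPair α hG k).snd

theorem measurable_query (hG : ∀ i, Measurable (Function.uncurry (G i))) (k : ℕ) :
    Measurable (P.query α G k) := by
  have h : P.query α G k = fun w => (1 + P.beta α) • P.iterate α G k w
      - P.beta α • P.prevIterate α G k w := funext fun w => P.query_eq α G k
  rw [h]
  exact ((P.measurable_iterate α hG k).const_smul (1 + P.beta α)).sub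
    ((P.measurable_prevIterate α hG k).const_smul (P.beta α))

theorem measurable_query_apply (hG : ∀ i, Measurable (Function.uncurry (G i))) (k : ℕ)
    (i : Fin N) : Measurable fun w => P.query α G k w i :=
  (PiLp.continuous_apply 2 _ i).measurable.comp (P.measurable_query α hG k)

theorem measurable_noise (hL : 0 < P.L) (hG : ∀ i, Measurable (Function.uncurry (G i)))
    (k : ℕ) : Measurable (P.noise α G k) := by
  refine (WithLp.measurable_toLp 2 _).comp (measurable_pi_lambda _ fun i => ?_)
  have hwi : Measurable fun w : ℕ → Fin N → Z => w k i := by fun_prop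
  have hy := P.measurable_query_apply α hG k i
  exact ((hG i).comp (hy.prodMk hwi)).sub
    (((P.curvatureBounds_local i).continuous_gradient P.mu_pos.le hL).measurable.comp hy)

end Measurability

/-! ### Moments of the trajectory and of the noise -/

section Moments

variable {Ω Z : Type*} [MeasurableSpace Ω] [MeasurableSpace Z] {Pr : Measure Ω}
  {α : ℝ} {G : Fin N → Vec d → Z → Vec d} {w : ℕ → Fin N → Ω → Z}

/-- The realization of the random inputs at `ω`. -/
def inputs (w : ℕ → Fin N → Ω → Z) (ω : Ω) : ℕ → Fin N → Z := fun t j => w t j ω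

theorem measurable_inputs (hw : ∀ k i, Measurable (w k i)) : Measurable (inputs w) :=
  measurable_pi_lambda _ fun t => measurable_pi_lambda _ fun j => hw t j

theorem _root_.memLp_stack_apply {p : ENNReal} {x : Ω → Stack N d} (hx : MemLp x p Pr) (i : Fin N) :
    MemLp (fun ω => x ω i) p Pr :=
  hx.of_le ((PiLp.continuous_apply 2 _ i).comp_aestronglyMeasurable hx.1)
    (Filter.Eventually.of_forall fun ω => PiLp.norm_apply_le (x ω) i)

theorem _root_.memLp_nodeAverage {p : ENNReal} {x : Ω → Stack N d} (hx : MemLp x p Pr) :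
    MemLp (fun ω => nodeAverage (x ω)) p Pr := by
  change MemLp (fun ω => (N : ℝ)⁻¹ • ∑ i, x ω i) p Pr
  exact (memLp_finsetSum Finset.univ fun i _ => memLp_stack_apply hx i).const_smul (N : ℝ)⁻¹

theorem memLp_mix {x : Ω → Stack N d} (hx : MemLp x 2 Pr) :
    MemLp (fun ω => P.mix (x ω)) 2 Pr := by
  have hm : AEStronglyMeasurable (fun ω => P.mix (x ω)) Pr :=
    P.continuous_mix.comp_aestronglyMeasurable hx.1
  refine (memLp_two_iff_integrable_sq_norm hm).2 ?_
  simp_rw [Stack.norm_sq_eq_sum]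
  refine integrable_finsetSum _ fun i _ => ?_
  have : MemLp (fun ω => P.mix (x ω) i) 2 Pr :=
    memLp_finsetSum Finset.univ fun j _ => (memLp_stack_apply hx j).const_smul (P.W i j)
  exact (memLp_two_iff_integrable_sq_norm this.1).1 this

theorem memLp_noise (hL : 0 < P.L) (h : P.NoiseAssumption Pr α (P.beta α) G w) (k : ℕ) :
    MemLp (fun ω => P.noise α G k (inputs w ω)) 2 Pr := by
  have hm : AEStronglyMeasurable (fun ω => P.noise α G k (inputs w ω)) Pr :=
    ((P.measurable_noise α hL h.measurable_oracle k).comp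
      (measurable_inputs h.measurable_input)).aestronglyMeasurable
  refine (memLp_two_iff_integrable_sq_norm hm).2 ?_
  simp_rw [Stack.norm_sq_eq_sum]
  exact integrable_finsetSum _ fun i _ => h.finite_variance k i

theorem integrable_norm_sq_noise_apply (h : P.NoiseAssumption Pr α (P.beta α) G w) (k : ℕ)
    (i : Fin N) : Integrable (fun ω => ‖P.noise α G k (inputs w ω) i‖ ^ 2) Pr :=
  h.finite_variance k i

variable [IsProbabilityMeasure Pr]

theorem memLp_localGradients (hL : 0 < P.L) {x : Ω → Stack N d} (hx : MemLp x 2 Pr) :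
    MemLp (fun ω => P.localGradients (x ω)) 2 Pr := by
  have h : MemLp (fun ω => P.localGradients (x ω) - P.localGradients 0) 2 Pr := by
    refine hx.of_le_mul (c := P.L) ?_ (Filter.Eventually.of_forall fun ω => ?_)
    · exact ((P.continuous_localGradients hL).comp_aestronglyMeasurable hx.1).sub
        aestronglyMeasurable_const
    · simpa using P.norm_localGradients_sub_le hL (x ω) 0
  exact (h.add (memLp_const (P.localGradients 0))).ae_eq
    (Filter.Eventually.of_forall fun ω => by simp)

theorem memLp_iterate_prevIterate (hL : 0 < P.L) (h : P.NoiseAssumption Pr α (P.beta α) G w)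
    (k : ℕ) : MemLp (fun ω => P.iterate α G k (inputs w ω)) 2 Pr ∧
      MemLp (fun ω => P.prevIterate α G k (inputs w ω)) 2 Pr := by
  induction k with
  | zero => simp
  | succ k ih =>
    have hy : MemLp (fun ω => P.query α G k (inputs w ω)) 2 Pr :=
      (ih.1.const_smul (1 + P.beta α)).sub (ih.2.const_smul (P.beta α))
    refine ⟨?_, ih.1⟩
    simp_rw [iterate_succ]
    exact (P.memLp_mix hy).sub
      (((P.memLp_localGradients hL hy).add (P.memLp_noise hL h k)).const_smul α)

theorem memLp_iterate (hL : 0 < P.L) (h : P.NoiseAssumption Pr α (P.beta α) G w) (k : ℕ) :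
    MemLp (fun ω => P.iterate α G k (inputs w ω)) 2 Pr := (P.memLp_iterate_prevIterate hL h k).1

theorem memLp_prevIterate (hL : 0 < P.L) (h : P.NoiseAssumption Pr α (P.beta α) G w) (k : ℕ) :
    MemLp (fun ω => P.prevIterate α G k (inputs w ω)) 2 Pr :=
  (P.memLp_iterate_prevIterate hL h k).2

theorem memLp_query (hL : 0 < P.L) (h : P.NoiseAssumption Pr α (P.beta α) G w) (k : ℕ) :
    MemLp (fun ω => P.query α G k (inputs w ω)) 2 Pr :=
  ((P.memLp_iterate hL h k).const_smul (1 + P.beta α)).sub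
    ((P.memLp_prevIterate hL h k).const_smul (P.beta α))

theorem integral_norm_sq_noise_apply_le (h : P.NoiseAssumption Pr α (P.beta α) G w) (k : ℕ)
    (i : Fin N) : ∫ ω, ‖P.noise α G k (inputs w ω) i‖ ^ 2 ∂Pr ≤ P.σ ^ 2 := by
  have hy : Measurable fun ω => P.query α G k (inputs w ω) i :=
    (P.measurable_query_apply α h.measurable_oracle k i).comp
      (measurable_inputs h.measurable_input)
  have h1 := integral_condExp (μ := Pr)
    (f := fun ω => ‖P.noise α G k (inputs w ω) i‖ ^ 2) hy.comap_le
  rw [← h1]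
  refine (integral_mono_ae integrable_condExp (integrable_const _) (h.variance_le k i)).trans ?_
  simp

theorem integral_norm_sq_noise_le (h : P.NoiseAssumption Pr α (P.beta α) G w)
    (k : ℕ) : ∫ ω, ‖P.noise α G k (inputs w ω)‖ ^ 2 ∂Pr ≤ N * P.σ ^ 2 := by
  simp_rw [Stack.norm_sq_eq_sum]
  rw [integral_finsetSum _ fun i _ => P.integrable_norm_sq_noise_apply h k i]
  calc _ ≤ ∑ _i : Fin N, P.σ ^ 2 :=
        Finset.sum_le_sum fun i _ => P.integral_norm_sq_noise_apply_le h k i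
    _ = _ := by simp

/-- The noise of node `i` at step `k` is orthogonal to every square integrable function of the
other inputs. -/
theorem integral_inner_noise_apply (hL : 0 < P.L) (h : P.NoiseAssumption Pr α (P.beta α) G w)
    (k : ℕ) (i : Fin N) {φ : (ℕ → Fin N → Z) → Vec d} (hφ : Measurable φ)
    (hloc : ∀ u u' : ℕ → Fin N → Z, (∀ t j, (t, j) ≠ (k, i) → u t j = u' t j) → φ u = φ u')
    (hφL : MemLp (fun ω => φ (inputs w ω)) 2 Pr) :
    ∫ ω, inner ℝ (φ (inputs w ω)) (P.noise α G k (inputs w ω) i) ∂Pr = 0 := by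
  classical
  obtain ⟨ω₀⟩ : Nonempty Ω := nonempty_of_isProbabilityMeasure Pr
  set p : ℕ × Fin N := (k, i) with hp
  set X : Ω → ({q // q ≠ p} → Z) := fun ω q => w q.1.1 q.1.2 ω with hX
  -- The missing input at `(k, i)` is filled with the value at a fixed outcome `ω₀`. By `hloc` the
  -- filling does not affect `φ`, so `φ` becomes a function of the other inputs alone.
  set ext : ({q // q ≠ p} → Z) → ℕ → Fin N → Z := fun r t j =>
    if hq : (t, j) ≠ p then r ⟨(t, j), hq⟩ else w k i ω₀ with hext
  have hextm : Measurable ext := by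
    refine measurable_pi_lambda _ fun t => measurable_pi_lambda _ fun j => ?_
    by_cases hq : (t, j) ≠ p
    · simp only [hext, dif_pos hq]; exact measurable_pi_apply _
    · simp only [hext, dif_neg hq]; exact measurable_const
  have hagree : ∀ ω t j, (t, j) ≠ (k, i) → ext (X ω) t j = inputs w ω t j := by
    intro ω t j hq
    simp only [hext, hX, hp, ne_eq, hq, not_false_eq_true, dite_true, inputs]
  have hφe : ∀ ω, φ (ext (X ω)) = φ (inputs w ω) := fun ω => hloc _ _ (hagree ω)
  have hye : ∀ ω, P.query α G k (ext (X ω)) = P.query α G k (inputs w ω) := fun ω =>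
    P.query_congr α G k fun t ht => funext fun j => hagree ω t j fun hc => by
      simp only [Prod.mk.injEq] at hc; omega
  have hg : Measurable (gradient (P.f i)) :=
    ((P.curvatureBounds_local i).continuous_gradient P.mu_pos.le hL).measurable
  have hy : Measurable fun ω => P.query α G k (inputs w ω) i :=
    (P.measurable_query_apply α h.measurable_oracle k i).comp
      (measurable_inputs h.measurable_input)
  have hnL := memLp_stack_apply (P.memLp_noise hL h k) i
  have hgL := memLp_stack_apply (P.memLp_localGradients hL (P.memLp_query hL h k)) i
  have key := integral_inner_eq_zero_of_condExp (Pr := Pr) (X := X) (W := w k i)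
    (η := fun r => P.query α G k (ext r) i)
    (ψ := fun v z => G i v z - gradient (P.f i) v) (a := fun r => φ (ext r))
    (measurable_pi_lambda _ fun q => h.measurable_input _ _) (h.measurable_input k i)
    (iIndepFun.indepFun_rest (w := fun p : ℕ × Fin N => w p.1 p.2)
      (fun q => h.measurable_input _ _) h.indep p)
    ((P.measurable_query_apply α h.measurable_oracle k i).comp hextm)
    ((h.measurable_oracle i).sub (hg.comp measurable_fst))
    (by simp only [hye]; exact hnL)
    (by
      simp only [hye]
      have hGL : Integrable (fun ω => G i (P.query α G k (inputs w ω) i) (w k i ω)) Pr := by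
        have := (hnL.add hgL).integrable one_le_two
        refine this.congr (Filter.Eventually.of_forall fun ω => ?_)
        simp [noise_apply, inputs]
      have h1 := condExp_sub hGL (hgL.integrable one_le_two)
        (MeasurableSpace.comap (fun ω => P.query α G k (inputs w ω) i) inferInstance)
      have h2 : Pr[fun ω => P.localGradients (P.query α G k (inputs w ω)) i |
          MeasurableSpace.comap (fun ω => P.query α G k (inputs w ω) i) inferInstance]
          = fun ω => P.localGradients (P.query α G k (inputs w ω)) i := by
        refine condExp_of_stronglyMeasurable hy.comap_le ?_ (hgL.integrable one_le_two)
        exact (hg.comp (comap_measurable _)).stronglyMeasurable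
      have h3 := h.unbiased k i
      rw [h2] at h1
      refine h1.trans ?_
      filter_upwards [h3] with ω hω
      rw [Pi.sub_apply]
      exact sub_eq_zero.2 hω)
    (hφ.comp hextm) (by simp only [hφe]; exact hφL)
  simp only [hye, hφe] at key
  exact key

/-- The stacked noise at step `k` is orthogonal to every square integrable function of the
earlier inputs. -/
theorem integral_inner_noise (hL : 0 < P.L) (h : P.NoiseAssumption Pr α (P.beta α) G w)
    (k : ℕ) {φ : (ℕ → Fin N → Z) → Stack N d} (hφ : Measurable φ)
    (hloc : ∀ u u' : ℕ → Fin N → Z, (∀ t < k, u t = u' t) → φ u = φ u')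
    (hφL : MemLp (fun ω => φ (inputs w ω)) 2 Pr) :
    ∫ ω, inner ℝ (φ (inputs w ω)) (P.noise α G k (inputs w ω)) ∂Pr = 0 := by
  simp_rw [Stack.inner_eq_sum]
  rw [integral_finsetSum _ fun i _ => integrable_inner_of_memLp_two (memLp_stack_apply hφL i)
    (memLp_stack_apply (P.memLp_noise hL h k) i)]
  refine Finset.sum_eq_zero fun i _ => ?_
  refine P.integral_inner_noise_apply hL h k i (φ := fun u => φ u i)
    ((PiLp.continuous_apply 2 _ i).measurable.comp hφ) (fun u u' huu => ?_)
    (memLp_stack_apply hφL i)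
  simp only
  rw [hloc u u' fun t ht => funext fun j => huu t j fun hc => by
      simp only [Prod.mk.injEq] at hc; omega]

/-- The averaged noise at step `k` is orthogonal to every square integrable function of the
earlier inputs. -/
theorem integral_inner_nodeAverage_noise (hL : 0 < P.L)
    (h : P.NoiseAssumption Pr α (P.beta α) G w)
    (k : ℕ) {φ : (ℕ → Fin N → Z) → Vec d} (hφ : Measurable φ)
    (hloc : ∀ u u' : ℕ → Fin N → Z, (∀ t < k, u t = u' t) → φ u = φ u')
    (hφL : MemLp (fun ω => φ (inputs w ω)) 2 Pr) :
    ∫ ω, inner ℝ (φ (inputs w ω)) (nodeAverage (P.noise α G k (inputs w ω))) ∂Pr = 0 := by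
  simp_rw [nodeAverage, inner_smul_right, inner_sum]
  rw [integral_const_mul, integral_finsetSum _ fun i _ => integrable_inner_of_memLp_two hφL
    (memLp_stack_apply (P.memLp_noise hL h k) i)]
  rw [Finset.sum_eq_zero, mul_zero]
  intro i _
  refine P.integral_inner_noise_apply hL h k i hφ (fun u u' huu => ?_) hφL
  exact hloc u u' fun t ht => funext fun j => huu t j fun hc => by
      simp only [Prod.mk.injEq] at hc; omega

/-- Averaging over the nodes reduces the noise variance by the factor `N`. -/
theorem integral_norm_sq_nodeAverage_noise_le (hL : 0 < P.L)
    (h : P.NoiseAssumption Pr α (P.beta α) G w) (k : ℕ) :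
    ∫ ω, ‖nodeAverage (P.noise α G k (inputs w ω))‖ ^ 2 ∂Pr ≤ P.σ ^ 2 / N := by
  have hN : (N : ℝ) ≠ 0 := by
    have := P.two_le; positivity
  have hn := fun i => memLp_stack_apply (P.memLp_noise hL h k) i
  -- The noise of another node at the same step involves the query point and the input `(k, j)`
  -- only, never `(k, i)`; the cross terms therefore vanish and only `N` of the `N²` terms survive.
  have hoff : ∀ i j, j ≠ i → ∫ ω, inner ℝ (P.noise α G k (inputs w ω) j)
      (P.noise α G k (inputs w ω) i) ∂Pr = 0 := by
    intro i j hij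
    refine P.integral_inner_noise_apply hL h k i (φ := fun u => P.noise α G k u j)
      ((PiLp.continuous_apply 2 _ j).measurable.comp
        (P.measurable_noise α hL h.measurable_oracle k)) (fun u u' huu => ?_) (hn j)
    have e : P.query α G k u = P.query α G k u' :=
      P.query_congr α G k fun t ht => funext fun l => huu t l fun hc => by
        simp only [Prod.mk.injEq] at hc; omega
    rw [noise_apply, noise_apply, e, huu k j (by simp [hij])]
  have e1 : ∀ ω, ‖nodeAverage (P.noise α G k (inputs w ω))‖ ^ 2
      = (N : ℝ)⁻¹ ^ 2 * ∑ i, ∑ j, inner ℝ (P.noise α G k (inputs w ω) j)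
        (P.noise α G k (inputs w ω) i) := by
    intro ω
    rw [nodeAverage, norm_smul, mul_pow, Real.norm_eq_abs, sq_abs, ← real_inner_self_eq_norm_sq,
      inner_sum]
    simp_rw [sum_inner]
  simp_rw [e1]
  rw [integral_const_mul, integral_finsetSum _ fun i _ => integrable_finsetSum _ fun j _ =>
    integrable_inner_of_memLp_two (hn j) (hn i)]
  have e2 : ∀ i, ∫ ω, ∑ j, inner ℝ (P.noise α G k (inputs w ω) j)
      (P.noise α G k (inputs w ω) i) ∂Pr ≤ P.σ ^ 2 := by
    intro i
    rw [integral_finsetSum _ fun j _ => integrable_inner_of_memLp_two (hn j) (hn i),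
      Finset.sum_eq_single i (fun j _ hj => hoff i j hj) (by simp)]
    simp_rw [real_inner_self_eq_norm_sq]
    exact P.integral_norm_sq_noise_apply_le h k i
  calc _ ≤ (N : ℝ)⁻¹ ^ 2 * ∑ _i : Fin N, P.σ ^ 2 := by gcongr with i; exact e2 i
    _ = _ := by simp; field_simp

end Moments

end DecentralizedProblem
end

noncomputable section

/-! ### Stochastic accelerated gradient steps -/

section StochasticStep

variable {Ω E : Type*} [MeasurableSpace Ω] {Pr : Measure Ω} [IsProbabilityMeasure Pr]
  [NormedAddCommGroup E] [InnerProductSpace ℝ E] {μ L α s : ℝ} {g : E → ℝ} {g' : E → E} {z : E}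

theorem CurvatureBounds.memLp_gradient (h : CurvatureBounds μ L g g') (hμ : 0 ≤ μ) (hL : 0 < L)
    {x : Ω → E} (hx : MemLp x 2 Pr) : MemLp (fun ω => g' (x ω)) 2 Pr := by
  have h1 : MemLp (fun ω => g' (x ω) - g' 0) 2 Pr := by
    refine hx.of_le_mul (c := L) ?_ (Filter.Eventually.of_forall fun ω => ?_)
    · exact ((h.continuous_gradient hμ hL).comp_aestronglyMeasurable hx.1).sub
        aestronglyMeasurable_const
    · simpa using h.lipschitz hμ hL (x ω) 0
  exact (h1.add (memLp_const (g' 0))).ae_eq (Filter.Eventually.of_forall fun ω => by simp)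

theorem CurvatureBounds.integrable_asgLyapunov (h : CurvatureBounds μ L g g') (hg : Continuous g)
    (hμ : 0 ≤ μ) (hz : g' z = 0) {x x' : Ω → E} (hx : MemLp x 2 Pr) (hx' : MemLp x' 2 Pr) :
    Integrable (fun ω => asgLyapunov α s g z (x ω) (x' ω)) Pr := by
  have h1 : MemLp (fun ω => x ω - z) 2 Pr := hx.sub (memLp_const z)
  have h2 : MemLp (fun ω => (x ω - z) - (1 - s) • (x' ω - z)) 2 Pr :=
    h1.sub ((hx'.sub (memLp_const z)).const_smul (1 - s))
  refine (((memLp_two_iff_integrable_sq_norm h2.1).1 h2).const_mul (1 / (2 * α))).add ?_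
  refine Integrable.mono' (((memLp_two_iff_integrable_sq_norm h1.1).1 h1).const_mul (L / 2))
    ((hg.comp_aestronglyMeasurable hx.1).sub aestronglyMeasurable_const)
    (Filter.Eventually.of_forall fun ω => ?_)
  have h3 := h.lower_of_stationary hz (x ω)
  have h4 : 0 ≤ μ / 2 * ‖x ω - z‖ ^ 2 := by positivity
  rw [Real.norm_of_nonneg (by linarith)]
  exact h.upper_of_stationary hz (x ω)

/-- Expected decrease of the Lyapunov function under bias `b` and noise `n`. -/
theorem CurvatureBounds.integral_asgLyapunov_le (h : CurvatureBounds μ L g g')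
    (hg : Continuous g) (hμ : 0 < μ) (hL : 0 < L) (hα : 0 < α) (hs : 0 < s) (hs1 : s ≤ 1)
    (hsq : s ^ 2 = α * μ) (hαL : α * L ≤ 1) (hz : g' z = 0) {x x' y b n xn : Ω → E}
    (hxL : MemLp x 2 Pr) (hxL' : MemLp x' 2 Pr) (hbL : MemLp b 2 Pr) (hnL : MemLp n 2 Pr)
    (hxnL : MemLp xn 2 Pr)
    (hy : ∀ ω, y ω - x ω = ((1 - s) / (1 + s)) • (x ω - x' ω))
    (hxn : ∀ ω, xn ω = y ω - α • (g' (y ω) + (b ω + n ω)))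
    (horth : let a : Ω → E := fun ω => (y ω - x ω) + s • (x ω - z) - (L * α ^ 2) • g' (y ω)
        - (α * (1 + L * α)) • b ω
      MemLp a 2 Pr → ∫ ω, inner ℝ (a ω) (n ω) ∂Pr = 0)
    {B V : ℝ} (hB : ∫ ω, ‖b ω‖ ^ 2 ∂Pr ≤ B) (hV : ∫ ω, ‖n ω‖ ^ 2 ∂Pr ≤ V) :
    ∫ ω, asgLyapunov α s g z (xn ω) (x ω) ∂Pr ≤
      (1 - s / 2) * ∫ ω, asgLyapunov α s g z (x ω) (x' ω) ∂Pr
        + (((12 + 4 * L / μ) * α / s + α) * B + α / 2 * (1 + L * α) * V) := by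
  have hyxL : MemLp (fun ω => y ω - x ω) 2 Pr := by
    simp_rw [hy]; exact (hxL.sub hxL').const_smul _
  have hyL : MemLp y 2 Pr :=
    (hyxL.add hxL).ae_eq (Filter.Eventually.of_forall fun ω => by simp)
  have haL : MemLp (fun ω => (y ω - x ω) + s • (x ω - z) - (L * α ^ 2) • g' (y ω)
      - (α * (1 + L * α)) • b ω) 2 Pr :=
    ((hyxL.add ((hxL.sub (memLp_const z)).const_smul s)).sub
      ((h.memLp_gradient hμ.le hL hyL).const_smul (L * α ^ 2))).sub
      (hbL.const_smul (α * (1 + L * α)))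
  -- The bias enters the vector paired with the noise as well, so orthogonality is required for the
  -- whole combination.
  have h0 := horth haL
  have hVi := h.integrable_asgLyapunov (α := α) (s := s) hg hμ.le hz hxL hxL'
  have hVn := h.integrable_asgLyapunov (α := α) (s := s) hg hμ.le hz hxnL hxL
  have hbi := (memLp_two_iff_integrable_sq_norm hbL.1).1 hbL
  have hni := (memLp_two_iff_integrable_sq_norm hnL.1).1 hnL
  have hai := integrable_inner_of_memLp_two haL hnL
  have i1 := hVi.const_mul (1 - s / 2)
  have i2 := hbi.const_mul ((12 + 4 * L / μ) * α / s + α)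
  have i3 := hni.const_mul (α / 2 * (1 + L * α))
  have hmono := integral_mono hVn (((i1.add i2).sub hai).add i3) fun ω =>
    h.asg_step_bias hμ hL hα hs hs1 hsq hαL hz (x ω) (x' ω) (y ω) (b ω) (n ω) (xn ω) (hy ω) (hxn ω)
  refine hmono.trans ?_
  rw [integral_add' ((i1.add i2).sub hai) i3, integral_sub' (i1.add i2) hai,
    integral_add' i1 i2, integral_const_mul, integral_const_mul, integral_const_mul, h0]
  have e1 : ((12 + 4 * L / μ) * α / s + α) * ∫ ω, ‖b ω‖ ^ 2 ∂Pr
      ≤ ((12 + 4 * L / μ) * α / s + α) * B := by gcongr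
  have e2 : α / 2 * (1 + L * α) * ∫ ω, ‖n ω‖ ^ 2 ∂Pr ≤ α / 2 * (1 + L * α) * V := by gcongr
  linarith

end StochasticStep

namespace DecentralizedProblem

variable {N d : ℕ} (P : DecentralizedProblem N d)

/-! ### Boundedness of the iterates -/

theorem beta_nonneg {α : ℝ} (h : α * P.μ ≤ 1) : 0 ≤ P.beta α := by
  have : √(α * P.μ) ≤ 1 := Real.sqrt_le_one.2 h
  unfold beta
  exact div_nonneg (by linarith) (by positivity)

theorem beta_le_one (α : ℝ) : P.beta α ≤ 1 := by
  have := Real.sqrt_nonneg (α * P.μ)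
  unfold beta
  rw [div_le_one (by positivity)]
  linarith

theorem continuous_objective : Continuous P.objective := by
  have := fun i => (P.local_class i).differentiable.continuous
  unfold objective
  fun_prop

theorem continuous_penalized (α : ℝ) : Continuous (P.penalized α) := by
  have h1 := fun i => (P.local_class i).differentiable.continuous
  have h2 := P.continuous_mix
  have h3 : Continuous P.F := by
    unfold F
    fun_prop
  unfold penalized
  fun_prop

theorem query_sub_iterate {Z : Type*} (α : ℝ) (G : Fin N → Vec d → Z → Vec d) (k : ℕ)
    (w : ℕ → Fin N → Z) : P.query α G k w - P.iterate α G k w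
      = ((1 - √(α * P.μ)) / (1 + √(α * P.μ))) • (P.iterate α G k w - P.prevIterate α G k w) := by
  rw [query_eq, beta]; module

/-- Uniform in `β ∈ [0, 1]`, hence in `α`. The sum `8 + 2` is the factor `10` occurring in
`gradientBound` and `biasFactor`. -/
theorem norm_query_combination_sq_le {E : Type*} [NormedAddCommGroup E] [InnerProductSpace ℝ E]
    {β : ℝ} (hβ : 0 ≤ β) (hβ1 : β ≤ 1) (a b : E) :
    ‖(1 + β) • a - β • b‖ ^ 2 ≤ 8 * ‖a‖ ^ 2 + 2 * ‖b‖ ^ 2 := by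
  have h := norm_sub_sq_le_two ((1 + β) • a) (β • b)
  rw [norm_smul, norm_smul, Real.norm_of_nonneg hβ, Real.norm_of_nonneg (by positivity), mul_pow,
    mul_pow] at h
  have h1 : (1 + β) ^ 2 * ‖a‖ ^ 2 ≤ 4 * ‖a‖ ^ 2 := by gcongr; nlinarith
  have h2 : β ^ 2 * ‖b‖ ^ 2 ≤ 1 * ‖b‖ ^ 2 := by gcongr; nlinarith
  linarith

/-- A bound for the second moments of the iterates. -/
def iterateBound : ℝ := 12 / P.μ * (P.initialGap + N * P.σ ^ 2 / P.μ)

theorem iterateBound_nonneg : 0 ≤ P.iterateBound := by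
  have := P.mu_pos
  have := P.initialGap_nonneg
  unfold iterateBound
  positivity

/-- A bound for the second moment of the stacked gradient estimates. -/
def gradientBound : ℝ :=
  2 * (2 * P.L ^ 2 * (10 * P.iterateBound) + 2 * ‖P.localGradients 0‖ ^ 2) + 2 * (N * P.σ ^ 2)

theorem gradientBound_nonneg : 0 ≤ P.gradientBound := by
  have := P.iterateBound_nonneg
  unfold gradientBound
  positivity

section Bounds

variable {Ω Z : Type*} [MeasurableSpace Ω] [MeasurableSpace Z] {Pr : Measure Ω}
  [IsProbabilityMeasure Pr] {α : ℝ} {G : Fin N → Vec d → Z → Vec d} {w : ℕ → Fin N → Ω → Z}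

/-- Accelerated descent on the penalized objective with zero bias. The condition `αL ≤ λ_N` is what
makes `α` times its smoothness constant at most one. -/
theorem integral_penalized_lyapunov_le (hL : 0 < P.L) (hα : 0 < α) (hαμ : α * P.μ ≤ 1)
    (hαl : α * P.L ≤ P.lambdaMin) (h : P.NoiseAssumption Pr α (P.beta α) G w) {z : Stack N d}
    (hz : P.IsFixedPoint α z) (k : ℕ) :
    ∫ ω, asgLyapunov α √(α * P.μ) (P.penalized α) z (P.iterate α G k (inputs w ω))
      (P.prevIterate α G k (inputs w ω)) ∂Pr ≤ 2 * (P.initialGap + N * P.σ ^ 2 / P.μ) := by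
  have hμ := P.mu_pos
  set s := √(α * P.μ) with hs
  have hs0 : 0 < s := Real.sqrt_pos.2 (by positivity)
  have hs1 : s ≤ 1 := Real.sqrt_le_one.2 hαμ
  have hsq : s ^ 2 = α * P.μ := Real.sq_sqrt (by positivity)
  set Λ := (1 - P.lambdaMin) / α + P.L with hΛ
  have hl1 := P.lambdaMin_le_one
  have hΛ0 : 0 < Λ := by
    have : 0 ≤ (1 - P.lambdaMin) / α := div_nonneg (by linarith) hα.le
    linarith
  have hαΛ : α * Λ ≤ 1 := by
    have : α * Λ = 1 - P.lambdaMin + α * P.L := by rw [hΛ]; field_simp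
    linarith
  have hc : CurvatureBounds P.μ Λ (P.penalized α) (P.penalizedGradient α) :=
    P.curvatureBounds_penalized hα
  have hz0 := P.penalizedGradient_eq_zero hα hz
  have hrec := fun k => hc.integral_asgLyapunov_le (Pr := Pr) (s := s) (P.continuous_penalized α)
    hμ hΛ0 hα hs0 hs1 hsq hαΛ hz0
    (x := fun ω => P.iterate α G k (inputs w ω)) (x' := fun ω => P.prevIterate α G k (inputs w ω))
    (y := fun ω => P.query α G k (inputs w ω)) (b := fun _ => 0)
    (n := fun ω => P.noise α G k (inputs w ω))
    (xn := fun ω => P.iterate α G (k + 1) (inputs w ω))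
    (P.memLp_iterate hL h k) (P.memLp_prevIterate hL h k) (memLp_const 0) (P.memLp_noise hL h k)
    (P.memLp_iterate hL h (k + 1)) (fun ω => P.query_sub_iterate α G k _)
    (fun ω => by simpa using P.iterate_succ_eq_penalized G hα k)
    (by
      intro a ha
      have hmq := P.measurable_query α h.measurable_oracle k
      have hmi := P.measurable_iterate α h.measurable_oracle k
      refine P.integral_inner_noise hL h k (φ := fun u => (P.query α G k u - P.iterate α G k u)
        + s • (P.iterate α G k u - z) - (Λ * α ^ 2) • P.penalizedGradient α (P.query α G k u)
        - (α * (1 + Λ * α)) • 0) ?_ (fun u u' huu => ?_) ha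
      · have := (hc.continuous_gradient hμ.le hΛ0).measurable.comp hmq
        exact (((hmq.sub hmi).add ((hmi.sub_const z).const_smul s)).sub
          (this.const_smul (Λ * α ^ 2))).sub measurable_const
      · simp only [P.query_congr α G k huu, P.iterate_congr α G k huu])
    (B := 0) (by simp) (P.integral_norm_sq_noise_le h k)
  have hmain := le_of_affine_recursion
    (a := fun k => ∫ ω, asgLyapunov α s (P.penalized α) z (P.iterate α G k (inputs w ω))
      (P.prevIterate α G k (inputs w ω)) ∂Pr)
    (q := 1 - s / 2) (c := α / 2 * (1 + Λ * α) * (N * P.σ ^ 2))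
    (by linarith) (by linarith) (by positivity) (fun k => by simpa [prevIterate_succ] using hrec k) k
  refine hmain.trans ?_
  have h0 : asgLyapunov α s (P.penalized α) z 0 0 ≤ 2 * P.initialGap := by
    rw [asgLyapunov_self hα hsq]
    have h1 := hc.lower_of_stationary hz0 0
    have h2 := P.penalized_sub_le_initialGap hα z
    linarith
  have h0' : 0 ≤ asgLyapunov α s (P.penalized α) z 0 0 :=
    hc.asgLyapunov_nonneg hμ.le hα s hz0 0 0
  have hq : (1 - s / 2) ^ k ≤ 1 := pow_le_one₀ (by linarith) (by linarith)
  -- Summing the geometric series divides the noise by `s/2`. Since `α = s²/μ ≤ s/μ`, the result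
  -- stays bounded as `α` tends to zero.
  have hc2 : α / 2 * (1 + Λ * α) * (N * P.σ ^ 2) / (1 - (1 - s / 2)) ≤ 2 * (N * P.σ ^ 2 / P.μ) := by
    have e : 1 - (1 - s / 2) = s / 2 := by ring
    rw [e, div_le_iff₀ (by positivity)]
    have e2 : 2 * (N * P.σ ^ 2 / P.μ) * (s / 2) = (s / P.μ) * (N * P.σ ^ 2) := by ring
    rw [e2]
    gcongr
    calc α / 2 * (1 + Λ * α) ≤ α / 2 * 2 := by gcongr; linarith
      _ = s ^ 2 / P.μ := by rw [hsq]; field_simp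
      _ ≤ s / P.μ := by gcongr; nlinarith
  simp only [iterate_zero, prevIterate_zero, integral_const, probReal_univ, one_smul]
  nlinarith

theorem integral_norm_sq_iterate_le (hL : 0 < P.L) (hα : 0 < α) (hαμ : α * P.μ ≤ 1)
    (hαl : α * P.L ≤ P.lambdaMin) (h : P.NoiseAssumption Pr α (P.beta α) G w) {z : Stack N d}
    (hz : P.IsFixedPoint α z) (k : ℕ) :
    ∫ ω, ‖P.iterate α G k (inputs w ω)‖ ^ 2 ∂Pr ≤ P.iterateBound := by
  have hμ := P.mu_pos
  have hc := P.curvatureBounds_penalized hα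
  have hz0 := P.penalizedGradient_eq_zero hα hz
  have hV := P.integral_penalized_lyapunov_le hL hα hαμ hαl h hz k
  have hxL := P.memLp_iterate hL h k
  have hVi := hc.integrable_asgLyapunov (α := α) (s := √(α * P.μ)) (P.continuous_penalized α)
    hμ.le hz0 hxL (P.memLp_prevIterate hL h k)
  have hz2 : ‖z‖ ^ 2 ≤ 2 / P.μ * P.initialGap := by
    have h1 := hc.lower_of_stationary hz0 0
    have h2 := P.penalized_sub_le_initialGap hα z
    rw [zero_sub, norm_neg] at h1
    calc ‖z‖ ^ 2 = 2 / P.μ * (P.μ / 2 * ‖z‖ ^ 2) := by field_simp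
      _ ≤ _ := by gcongr; linarith
  have hmono := integral_mono ((memLp_two_iff_integrable_sq_norm hxL.1).1 hxL)
    ((hVi.const_mul (4 / P.μ)).add (integrable_const (2 * ‖z‖ ^ 2))) fun ω => by
      have h1 := norm_add_sq_le_two (P.iterate α G k (inputs w ω) - z) z
      have h2 := hc.norm_sub_sq_le_asgLyapunov hα hμ √(α * P.μ) hz0
        (P.iterate α G k (inputs w ω)) (P.prevIterate α G k (inputs w ω))
      rw [sub_add_cancel] at h1
      have e : 4 / P.μ = 2 * (2 / P.μ) := by ring
      simp only [Pi.add_apply, e]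
      linarith
  refine hmono.trans ?_
  rw [integral_add' (hVi.const_mul _) (integrable_const _), integral_const_mul]
  simp only [integral_const, probReal_univ, one_smul]
  have h3 : 4 / P.μ * ∫ ω, asgLyapunov α √(α * P.μ) (P.penalized α) z
      (P.iterate α G k (inputs w ω)) (P.prevIterate α G k (inputs w ω)) ∂Pr
      ≤ 4 / P.μ * (2 * (P.initialGap + N * P.σ ^ 2 / P.μ)) := by gcongr
  have h4 : 0 ≤ 4 / P.μ * (N * P.σ ^ 2 / P.μ) := by positivity
  -- The last summand is surplus, used only to round the constant up to a common factor `12/μ`.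
  have e : P.iterateBound = 4 / P.μ * (2 * (P.initialGap + N * P.σ ^ 2 / P.μ))
      + 2 * (2 / P.μ * P.initialGap) + 4 / P.μ * (N * P.σ ^ 2 / P.μ) := by
    unfold iterateBound; ring
  linarith

theorem integral_norm_sq_prevIterate_le (hL : 0 < P.L) (hα : 0 < α) (hαμ : α * P.μ ≤ 1)
    (hαl : α * P.L ≤ P.lambdaMin) (h : P.NoiseAssumption Pr α (P.beta α) G w) {z : Stack N d}
    (hz : P.IsFixedPoint α z) (k : ℕ) :
    ∫ ω, ‖P.prevIterate α G k (inputs w ω)‖ ^ 2 ∂Pr ≤ P.iterateBound := by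
  cases k with
  | zero => simpa using P.iterateBound_nonneg
  | succ k => exact P.integral_norm_sq_iterate_le hL hα hαμ hαl h hz k

/-- The stacked gradient estimates have bounded second moment. -/
theorem integral_norm_sq_gradient_le (hL : 0 < P.L) (hα : 0 < α) (hαμ : α * P.μ ≤ 1)
    (hαl : α * P.L ≤ P.lambdaMin) (h : P.NoiseAssumption Pr α (P.beta α) G w) {z : Stack N d}
    (hz : P.IsFixedPoint α z) (k : ℕ) :
    ∫ ω, ‖P.localGradients (P.query α G k (inputs w ω)) + P.noise α G k (inputs w ω)‖ ^ 2 ∂Pr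
      ≤ P.gradientBound := by
  have hx := P.memLp_iterate hL h k
  have hx' := P.memLp_prevIterate hL h k
  have hn := P.memLp_noise hL h k
  have hg := P.memLp_localGradients hL (P.memLp_query hL h k)
  have hxi := (memLp_two_iff_integrable_sq_norm hx.1).1 hx
  have hxi' := (memLp_two_iff_integrable_sq_norm hx'.1).1 hx'
  have hni := (memLp_two_iff_integrable_sq_norm hn.1).1 hn
  have hgn := hg.add hn
  have hgni := (memLp_two_iff_integrable_sq_norm hgn.1).1 hgn
  have i1 := hxi.const_mul (32 * P.L ^ 2)
  have i2 := hxi'.const_mul (8 * P.L ^ 2)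
  have i3 := hni.const_mul 2
  have i4 := integrable_const (μ := Pr) (4 * ‖P.localGradients 0‖ ^ 2)
  have hmono := integral_mono hgni (((i1.add i2).add i3).add i4) fun ω => by
    have h1 := norm_add_sq_le_two (P.localGradients (P.query α G k (inputs w ω)))
      (P.noise α G k (inputs w ω))
    have h2 := norm_add_sq_le_two (P.localGradients (P.query α G k (inputs w ω))
      - P.localGradients 0) (P.localGradients 0)
    rw [sub_add_cancel] at h2
    have h3 := P.norm_localGradients_sub_le hL (P.query α G k (inputs w ω)) 0
    rw [sub_zero] at h3
    have h4 := pow_le_pow_left₀ (norm_nonneg _) h3 2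
    have h5 := norm_query_combination_sq_le (P.beta_nonneg hαμ) (P.beta_le_one α)
      (P.iterate α G k (inputs w ω)) (P.prevIterate α G k (inputs w ω))
    rw [← query_eq] at h5
    have h6 := mul_le_mul_of_nonneg_left h5 (sq_nonneg P.L)
    rw [mul_pow] at h4
    simp only [Pi.add_apply]
    linarith
  refine hmono.trans ?_
  rw [integral_add' ((i1.add i2).add i3) i4, integral_add' (i1.add i2) i3, integral_add' i1 i2,
    integral_const_mul, integral_const_mul, integral_const_mul]
  simp only [integral_const, probReal_univ, one_smul]
  have h1 := mul_le_mul_of_nonneg_left (P.integral_norm_sq_iterate_le hL hα hαμ hαl h hz k)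
    (sq_nonneg P.L)
  have h2 := mul_le_mul_of_nonneg_left (P.integral_norm_sq_prevIterate_le hL hα hαμ hαl h hz k)
    (sq_nonneg P.L)
  have h3 := P.integral_norm_sq_noise_le h k
  unfold gradientBound
  linarith

end Bounds

/-! ### Disagreement between the nodes -/

/-- The amplification factor of the momentum recursion in a mode with eigenvalue `l`. -/
def modeFactor (l : ℝ) : ℝ :=
  (1 + 2 / (1 / l - 1)) / l / ((1 - l) / 2) / (1 / l - 1)

theorem modeFactor_nonneg {l : ℝ} (hl : 0 < l) (hl1 : l < 1) : 0 ≤ modeFactor l := by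
  have : 0 < 1 / l - 1 := by rw [sub_pos, lt_div_iff₀ hl]; linarith
  have : 0 < 1 - l := by linarith
  unfold modeFactor
  positivity

/-- A bound for `E ∑ i, ‖x_i - x̄‖²`, up to the factor `α²`. -/
def consensusBound : ℝ :=
  ∑ k, if P.eig k = 1 then 0 else modeFactor (P.eig k) * P.gradientBound

theorem consensusBound_nonneg (hlam : 0 < P.lambdaMin) : 0 ≤ P.consensusBound := by
  refine Finset.sum_nonneg fun k _ => ?_
  split_ifs with hk
  · exact le_rfl
  · exact mul_nonneg (modeFactor_nonneg (hlam.trans_le (P.lambdaMin_le_eig k))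
      (lt_of_le_of_ne (P.eig_le_one k) hk)) P.gradientBound_nonneg

theorem component_smul {E : Type*} [AddCommGroup E] [Module ℝ E] (k : Fin N) (c : ℝ)
    (x : Fin N → E) : P.component k (fun i => c • x i) = c • P.component k x := by
  simp_rw [component, Finset.smul_sum, smul_comm c]

theorem component_sub {E : Type*} [AddCommGroup E] [Module ℝ E] (k : Fin N)
    (x y : Fin N → E) : P.component k (fun i => x i - y i) = P.component k x - P.component k y := by
  simp_rw [component, smul_sub, Finset.sum_sub_distrib]

theorem component_iterate_succ {Z : Type*} (α : ℝ) (G : Fin N → Vec d → Z → Vec d) (k : ℕ)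
    (w : ℕ → Fin N → Z) (j : Fin N) : P.component j (P.iterate α G (k + 1) w)
      = P.eig j • ((1 + P.beta α) • P.component j (P.iterate α G k w)
          - P.beta α • P.component j (P.prevIterate α G k w))
        + (-α) • P.component j (P.localGradients (P.query α G k w) + P.noise α G k w) := by
  have h1 : (P.iterate α G (k + 1) w : Fin N → Vec d) = fun i =>
      P.mix (P.query α G k w) i
        - α • (P.localGradients (P.query α G k w) + P.noise α G k w) i := by
    rw [iterate_succ]; rfl
  have h2 : (P.query α G k w : Fin N → Vec d) = fun i =>
      (1 + P.beta α) • P.iterate α G k w i - P.beta α • P.prevIterate α G k w i := by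
    rw [query_eq]; rfl
  rw [h1, component_sub, component_smul, neg_smul, ← sub_eq_add_neg]
  congr 1
  change P.component j (fun i => ∑ l, P.W i l • P.query α G k w l) = _
  rw [component_mix, h2, component_sub, component_smul, component_smul]

section Consensus

variable {Ω Z : Type*} [MeasurableSpace Ω] [MeasurableSpace Z] {Pr : Measure Ω}
  {α : ℝ} {G : Fin N → Vec d → Z → Vec d} {w : ℕ → Fin N → Ω → Z}

theorem memLp_component {x : Ω → Stack N d} (hx : MemLp x 2 Pr) (j : Fin N) :
    MemLp (fun ω => P.component j (x ω)) 2 Pr :=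
  memLp_finsetSum Finset.univ fun i _ => (memLp_stack_apply hx i).const_smul (P.eigvec j i)

variable [IsProbabilityMeasure Pr]

/-- The forcing has second moment `O(α²)`, the contraction rate depends on the eigenvalue alone, and
the energy starts at zero, so there is no transient. Dividing the energy by `κ` recovers the
component. -/
theorem integral_norm_sq_component_le (hlam : 0 < P.lambdaMin) (hL : 0 < P.L) (hα : 0 < α)
    (hαμ : α * P.μ ≤ 1) (hαl : α * P.L ≤ P.lambdaMin)
    (h : P.NoiseAssumption Pr α (P.beta α) G w) {z : Stack N d} (hz : P.IsFixedPoint α z)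
    {j : Fin N} (hj : P.eig j ≠ 1) (k : ℕ) :
    ∫ ω, ‖P.component j (P.iterate α G k (inputs w ω))‖ ^ 2 ∂Pr
      ≤ α ^ 2 * (modeFactor (P.eig j) * P.gradientBound) := by
  have hl0 : 0 < P.eig j := hlam.trans_le (P.lambdaMin_le_eig j)
  have hl1 : P.eig j < 1 := lt_of_le_of_ne (P.eig_le_one j) hj
  set l := P.eig j with hl
  set κ := 1 / l - 1 with hκ
  have hκ0 : 0 < κ := by rw [hκ, sub_pos, lt_div_iff₀ hl0]; linarith
  set c : ℕ → Ω → Vec d := fun k ω => P.component j (P.iterate α G k (inputs w ω)) with hc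
  set c' : ℕ → Ω → Vec d := fun k ω => P.component j (P.prevIterate α G k (inputs w ω)) with hc'
  set r : ℕ → Ω → Vec d := fun k ω => (-α) • P.component j
    (P.localGradients (P.query α G k (inputs w ω)) + P.noise α G k (inputs w ω)) with hr
  have hcL : ∀ k, MemLp (c k) 2 Pr := fun k => P.memLp_component (P.memLp_iterate hL h k) j
  have hcL' : ∀ k, MemLp (c' k) 2 Pr := fun k => P.memLp_component (P.memLp_prevIterate hL h k) j
  have hgL : ∀ k, MemLp (fun ω => P.localGradients (P.query α G k (inputs w ω))
      + P.noise α G k (inputs w ω)) 2 Pr := fun k =>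
    (P.memLp_localGradients hL (P.memLp_query hL h k)).add (P.memLp_noise hL h k)
  have hrL : ∀ k, MemLp (r k) 2 Pr := fun k => (P.memLp_component (hgL k) j).const_smul (-α)
  have sqi : ∀ {E : Type} [NormedAddCommGroup E] {f : Ω → E}, MemLp f 2 Pr →
      Integrable (fun ω => ‖f ω‖ ^ 2) Pr := fun hf => (memLp_two_iff_integrable_sq_norm hf.1).1 hf
  have hdL : ∀ k, MemLp (fun ω => c k ω - c' k ω) 2 Pr := fun k => (hcL k).sub (hcL' k)
  have hEi : ∀ k, Integrable (fun ω => ‖c k ω - c' k ω‖ ^ 2 + κ * ‖c k ω‖ ^ 2) Pr := fun k =>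
    (sqi (hdL k)).add ((sqi (hcL k)).const_mul κ)
  have hr2 : ∀ k, ∫ ω, ‖r k ω‖ ^ 2 ∂Pr ≤ α ^ 2 * P.gradientBound := by
    intro k
    have hmono := integral_mono (sqi (hrL k)) ((sqi (hgL k)).const_mul (α ^ 2)) fun ω => by
      simp only [hr, norm_smul, mul_pow, norm_neg, Real.norm_eq_abs, sq_abs]
      refine mul_le_mul_of_nonneg_left ?_ (sq_nonneg α)
      rw [Stack.norm_sq_eq_sum]
      exact P.norm_sq_component_le j _
    refine hmono.trans ?_
    rw [integral_const_mul]
    gcongr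
    exact P.integral_norm_sq_gradient_le hL hα hαμ hαl h hz k
  have hcoef : 0 ≤ (1 + 2 / κ) / l := by positivity
  have hrec : ∀ k, ∫ ω, (‖c (k + 1) ω - c' (k + 1) ω‖ ^ 2 + κ * ‖c (k + 1) ω‖ ^ 2) ∂Pr
      ≤ (1 - (1 - l) / 2) * ∫ ω, (‖c k ω - c' k ω‖ ^ 2 + κ * ‖c k ω‖ ^ 2) ∂Pr
        + (1 + 2 / κ) / l * (α ^ 2 * P.gradientBound) := by
    intro k
    have i1 := (hEi k).const_mul (1 - (1 - l) / 2)
    have i2 := (sqi (hrL k)).const_mul ((1 + 2 / κ) / l)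
    have hmono := integral_mono (hEi (k + 1)) (i1.add i2) fun ω =>
      momentum_energy_step hl0 hl1 (P.beta_nonneg hαμ) (P.beta_le_one α) (c k ω) (c' k ω)
        (c (k + 1) ω) (r k ω) (P.component_iterate_succ α G k (inputs w ω) j)
    refine hmono.trans ?_
    rw [integral_add' i1 i2, integral_const_mul, integral_const_mul]
    gcongr
    exact hr2 k
  have hgb := P.gradientBound_nonneg
  have hmain := le_of_affine_recursion
    (a := fun k => ∫ ω, (‖c k ω - c' k ω‖ ^ 2 + κ * ‖c k ω‖ ^ 2) ∂Pr) (q := 1 - (1 - l) / 2)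
    (c := (1 + 2 / κ) / l * (α ^ 2 * P.gradientBound)) (by linarith) (by linarith)
    (by positivity) hrec k
  have h0 : ∫ ω, (‖c 0 ω - c' 0 ω‖ ^ 2 + κ * ‖c 0 ω‖ ^ 2) ∂Pr = 0 := by
    simp [hc, hc', component]
  rw [h0, mul_zero, zero_add, sub_sub_cancel] at hmain
  have hmono := integral_mono (sqi (hcL k)) ((hEi k).const_mul κ⁻¹) fun ω => by
    simp only
    rw [mul_add, inv_mul_cancel_left₀ hκ0.ne']
    have : 0 ≤ κ⁻¹ * ‖c k ω - c' k ω‖ ^ 2 := by positivity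
    linarith
  refine hmono.trans ?_
  rw [integral_const_mul]
  calc _ ≤ κ⁻¹ * ((1 + 2 / κ) / l * (α ^ 2 * P.gradientBound) / ((1 - l) / 2)) := by gcongr
    _ = _ := by rw [modeFactor, ← hκ]; ring

/-- The expected disagreement of the nodes is of order `α²`. -/
theorem integral_disagreement_le (hlam : 0 < P.lambdaMin) (hL : 0 < P.L) (hα : 0 < α)
    (hαμ : α * P.μ ≤ 1) (hαl : α * P.L ≤ P.lambdaMin)
    (h : P.NoiseAssumption Pr α (P.beta α) G w) {z : Stack N d} (hz : P.IsFixedPoint α z)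
    (k : ℕ) :
    ∫ ω, ∑ i, ‖P.iterate α G k (inputs w ω) i - nodeAverage (P.iterate α G k (inputs w ω))‖ ^ 2 ∂Pr
      ≤ α ^ 2 * P.consensusBound := by
  simp_rw [P.sum_norm_sub_average_sq]
  rw [integral_finsetSum, consensusBound, Finset.mul_sum]
  · refine Finset.sum_le_sum fun j _ => ?_
    split_ifs with hj
    · simp
    · exact P.integral_norm_sq_component_le hlam hL hα hαμ hαl h hz hj k
  · intro j _
    split_ifs with hj
    · exact integrable_const 0
    · have := P.memLp_component (P.memLp_iterate hL h k) j
      exact (memLp_two_iff_integrable_sq_norm this.1).1 this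

end Consensus

end DecentralizedProblem
end

noncomputable section

namespace DecentralizedProblem

variable {N d : ℕ} (P : DecentralizedProblem N d)

/-! ### The averaged iterate -/

theorem numNodes_pos (P : DecentralizedProblem N d) : (0 : ℝ) < N := by
  have := P.two_le
  positivity

theorem nodeAverage_sub (x y : Stack N d) :
    nodeAverage (x - y) = nodeAverage x - nodeAverage y := by
  simp [nodeAverage, Finset.sum_sub_distrib, smul_sub]

theorem nodeAverage_add (x y : Stack N d) :
    nodeAverage (x + y) = nodeAverage x + nodeAverage y := by
  simp [nodeAverage, Finset.sum_add_distrib, smul_add]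

theorem nodeAverage_smul (c : ℝ) (x : Stack N d) :
    nodeAverage (c • x) = c • nodeAverage x := by
  simp only [nodeAverage, PiLp.smul_apply, ← Finset.smul_sum]
  rw [smul_comm]

theorem nodeAverage_mix (x : Stack N d) : nodeAverage (P.mix x) = nodeAverage x := by
  simp only [nodeAverage, mix_apply]
  rw [Finset.sum_comm]
  simp_rw [← Finset.sum_smul, P.W_col_sum, one_smul]

/-- The gradient of the global objective. -/
def objectiveGradient (x : Vec d) : Vec d := (N : ℝ)⁻¹ • ∑ i, gradient (P.f i) x

/-- The deviation of the averaged local gradients from the gradient at the average. -/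
def gradientBias (y : Stack N d) : Vec d :=
  nodeAverage (P.localGradients y) - P.objectiveGradient (nodeAverage y)

/-- The bias is the mean of the differences of `∇f_i` between `y_i` and the average, so Lipschitz
bounds and Cauchy–Schwarz apply. -/
theorem norm_gradientBias_sq_le (hL : 0 < P.L) (y : Stack N d) :
    ‖P.gradientBias y‖ ^ 2 ≤ P.L ^ 2 / N * ∑ i, ‖y i - nodeAverage y‖ ^ 2 := by
  have hN := P.numNodes_pos
  have e : P.gradientBias y
      = (N : ℝ)⁻¹ • ∑ i, (gradient (P.f i) (y i) - gradient (P.f i) (nodeAverage y)) := by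
    simp only [gradientBias, objectiveGradient, Finset.sum_sub_distrib, smul_sub]
    rfl
  have h1 : ‖∑ i, (gradient (P.f i) (y i) - gradient (P.f i) (nodeAverage y))‖ ^ 2
      ≤ N * ∑ i, (P.L * ‖y i - nodeAverage y‖) ^ 2 := by
    have h2 : ‖∑ i, (gradient (P.f i) (y i) - gradient (P.f i) (nodeAverage y))‖
        ≤ ∑ i, P.L * ‖y i - nodeAverage y‖ :=
      (norm_sum_le _ _).trans (Finset.sum_le_sum fun i _ =>
        (P.curvatureBounds_local i).lipschitz P.mu_pos.le hL _ _)
    refine (pow_le_pow_left₀ (norm_nonneg _) h2 2).trans ?_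
    simpa using sq_sum_le_card_mul_sum_sq (s := Finset.univ)
      (f := fun i => P.L * ‖y i - nodeAverage y‖)
  rw [e, norm_smul, mul_pow, Real.norm_eq_abs, sq_abs]
  calc _ ≤ (N : ℝ)⁻¹ ^ 2 * (N * ∑ i, (P.L * ‖y i - nodeAverage y‖) ^ 2) := by gcongr
    _ = _ := by
      simp_rw [mul_pow, ← Finset.mul_sum]
      field_simp

theorem sum_query_disagreement_le {Z : Type*} {α : ℝ} (hαμ : α * P.μ ≤ 1)
    (G : Fin N → Vec d → Z → Vec d) (k : ℕ) (w : ℕ → Fin N → Z) :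
    ∑ i, ‖P.query α G k w i - nodeAverage (P.query α G k w)‖ ^ 2
      ≤ 8 * ∑ i, ‖P.iterate α G k w i - nodeAverage (P.iterate α G k w)‖ ^ 2
        + 2 * ∑ i, ‖P.prevIterate α G k w i - nodeAverage (P.prevIterate α G k w)‖ ^ 2 := by
  rw [Finset.mul_sum, Finset.mul_sum, ← Finset.sum_add_distrib]
  refine Finset.sum_le_sum fun i _ => ?_
  have h := norm_query_combination_sq_le (P.beta_nonneg hαμ) (P.beta_le_one α)
    (P.iterate α G k w i - nodeAverage (P.iterate α G k w))
    (P.prevIterate α G k w i - nodeAverage (P.prevIterate α G k w))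
  have e : P.query α G k w i - nodeAverage (P.query α G k w)
      = (1 + P.beta α) • (P.iterate α G k w i - nodeAverage (P.iterate α G k w))
        - P.beta α • (P.prevIterate α G k w i - nodeAverage (P.prevIterate α G k w)) := by
    rw [query_eq, nodeAverage_sub, nodeAverage_smul, nodeAverage_smul, PiLp.sub_apply,
      PiLp.smul_apply, PiLp.smul_apply]
    module
  rw [e]
  exact h

/-- Averaging is unaffected by mixing, so the average follows the accelerated method for `f`,
perturbed by a bias and the averaged noise. -/
theorem nodeAverage_iterate_succ {Z : Type*} (α : ℝ) (G : Fin N → Vec d → Z → Vec d) (k : ℕ)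
    (w : ℕ → Fin N → Z) : nodeAverage (P.iterate α G (k + 1) w)
      = nodeAverage (P.query α G k w) - α • (P.objectiveGradient (nodeAverage (P.query α G k w))
        + (P.gradientBias (P.query α G k w) + nodeAverage (P.noise α G k w))) := by
  rw [iterate_succ, nodeAverage_sub, nodeAverage_mix, nodeAverage_smul, nodeAverage_add,
    gradientBias]
  congr 2
  abel

/-- The constant of the `O(α)` contribution of the bias to the averaged Lyapunov function. -/
def biasFactor : ℝ :=
  2 * (12 + 4 * P.L / P.μ + 1) / P.μ ^ 2 * (10 * P.L ^ 2 / N * P.consensusBound)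

theorem biasFactor_nonneg (hlam : 0 < P.lambdaMin) (hL : 0 < P.L) : 0 ≤ P.biasFactor := by
  have := P.consensusBound_nonneg hlam
  have := P.mu_pos
  unfold biasFactor
  positivity

section Average

variable {Ω Z : Type*} [MeasurableSpace Ω] [MeasurableSpace Z] {Pr : Measure Ω}
  {α : ℝ} {G : Fin N → Vec d → Z → Vec d} {w : ℕ → Fin N → Ω → Z}

theorem integrable_disagreement {x : Ω → Stack N d} (hx : MemLp x 2 Pr) :
    Integrable (fun ω => ∑ i, ‖x ω i - nodeAverage (x ω)‖ ^ 2) Pr := by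
  refine integrable_finsetSum _ fun i _ => ?_
  have : MemLp (fun ω => x ω i - nodeAverage (x ω)) 2 Pr :=
    (memLp_stack_apply hx i).sub (memLp_nodeAverage hx)
  exact (memLp_two_iff_integrable_sq_norm this.1).1 this

variable [IsProbabilityMeasure Pr]

theorem memLp_gradientBias (hL : 0 < P.L) {y : Ω → Stack N d} (hy : MemLp y 2 Pr) :
    MemLp (fun ω => P.gradientBias (y ω)) 2 Pr :=
  (memLp_nodeAverage (P.memLp_localGradients hL hy)).sub
    (P.curvatureBounds_objective.memLp_gradient P.mu_pos.le hL (memLp_nodeAverage hy))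

theorem integral_norm_sq_gradientBias_le (hlam : 0 < P.lambdaMin) (hL : 0 < P.L) (hα : 0 < α)
    (hαμ : α * P.μ ≤ 1) (hαl : α * P.L ≤ P.lambdaMin)
    (h : P.NoiseAssumption Pr α (P.beta α) G w) {z : Stack N d} (hz : P.IsFixedPoint α z)
    (k : ℕ) :
    ∫ ω, ‖P.gradientBias (P.query α G k (inputs w ω))‖ ^ 2 ∂Pr
      ≤ α ^ 2 * (10 * P.L ^ 2 / N * P.consensusBound) := by
  have hb := P.memLp_gradientBias hL (P.memLp_query hL h k)
  have i1 := (integrable_disagreement (P.memLp_iterate hL h k)).const_mul (8 * P.L ^ 2 / N)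
  have i2 := (integrable_disagreement (P.memLp_prevIterate hL h k)).const_mul (2 * P.L ^ 2 / N)
  have hmono := integral_mono ((memLp_two_iff_integrable_sq_norm hb.1).1 hb) (i1.add i2)
    fun ω => by
      have h1 := P.norm_gradientBias_sq_le hL (P.query α G k (inputs w ω))
      have h2 := mul_le_mul_of_nonneg_left (P.sum_query_disagreement_le hαμ G k (inputs w ω))
        (a := P.L ^ 2 / N) (by positivity)
      refine (h1.trans h2).trans_eq ?_
      simp only [Pi.add_apply]
      ring
  refine hmono.trans ?_
  rw [integral_add' i1 i2, integral_const_mul, integral_const_mul]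
  have h1 := P.integral_disagreement_le hlam hL hα hαμ hαl h hz k
  have h2 : ∫ ω, ∑ i, ‖P.prevIterate α G k (inputs w ω) i
      - nodeAverage (P.prevIterate α G k (inputs w ω))‖ ^ 2 ∂Pr ≤ α ^ 2 * P.consensusBound := by
    cases k with
    | zero =>
      have := P.consensusBound_nonneg hlam
      have h0 : ∀ ω, ∑ i, ‖P.prevIterate α G 0 (inputs w ω) i
          - nodeAverage (P.prevIterate α G 0 (inputs w ω))‖ ^ 2 = 0 := fun ω => by
        simp [nodeAverage]
      simp only [h0, integral_zero]
      positivity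
    | succ k => exact P.integral_disagreement_le hlam hL hα hαμ hαl h hz k
  calc _ ≤ 8 * P.L ^ 2 / N * (α ^ 2 * P.consensusBound)
        + 2 * P.L ^ 2 / N * (α ^ 2 * P.consensusBound) := by gcongr
    _ = _ := by ring

theorem integral_norm_sq_nodeAverage_sub_le (hlam : 0 < P.lambdaMin) (hL : 0 < P.L) (hα : 0 < α)
    (hαL : α * P.L ≤ 1) (hαμ : α * P.μ ≤ 1) (hαl : α * P.L ≤ P.lambdaMin)
    (h : P.NoiseAssumption Pr α (P.beta α) G w) {z : Stack N d} (hz : P.IsFixedPoint α z)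
    {xs : Vec d} (hxs : ∀ x, P.objective xs ≤ P.objective x) (k : ℕ) :
    ∫ ω, ‖nodeAverage (P.iterate α G k (inputs w ω)) - xs‖ ^ 2 ∂Pr ≤
      (1 - √(α * P.μ) / 2) ^ k * (2 * P.Vbar₀ α xs / P.μ) + 2 / P.μ * (α * P.biasFactor)
        + 2 * P.σ ^ 2 * √α / (P.μ * √P.μ * N) * (1 + α * P.L) := by
  have hμ := P.mu_pos
  have hN := P.numNodes_pos
  have hcb := P.consensusBound_nonneg hlam
  obtain ⟨s, hs⟩ : ∃ s, s = √(α * P.μ) := ⟨_, rfl⟩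
  have hs0 : 0 < s := hs ▸ Real.sqrt_pos.2 (by positivity)
  have hs1 : s ≤ 1 := hs ▸ Real.sqrt_le_one.2 hαμ
  have hsq : s ^ 2 = α * P.μ := hs ▸ Real.sq_sqrt (by positivity)
  have hc : CurvatureBounds P.μ P.L P.objective P.objectiveGradient := P.curvatureBounds_objective
  have hz0 := hc.gradient_eq_zero hL hxs
  have hcg := hc.continuous_gradient hμ.le hL
  set X : ℕ → Ω → Vec d := fun k ω => nodeAverage (P.iterate α G k (inputs w ω)) with hX
  set X' : ℕ → Ω → Vec d := fun k ω => nodeAverage (P.prevIterate α G k (inputs w ω)) with hX'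
  have hXL : ∀ k, MemLp (X k) 2 Pr := fun k => memLp_nodeAverage (P.memLp_iterate hL h k)
  have hXL' : ∀ k, MemLp (X' k) 2 Pr := fun k => memLp_nodeAverage (P.memLp_prevIterate hL h k)
  set b₀ := 10 * P.L ^ 2 / N * P.consensusBound with hb₀
  have hb₀0 : 0 ≤ b₀ := by positivity
  have hrec := fun k => hc.integral_asgLyapunov_le (Pr := Pr) (s := s) P.continuous_objective
    hμ hL hα hs0 hs1 hsq hαL hz0 (x := X k) (x' := X' k)
    (y := fun ω => nodeAverage (P.query α G k (inputs w ω)))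
    (b := fun ω => P.gradientBias (P.query α G k (inputs w ω)))
    (n := fun ω => nodeAverage (P.noise α G k (inputs w ω))) (xn := X (k + 1))
    (hXL k) (hXL' k) (P.memLp_gradientBias hL (P.memLp_query hL h k))
    (memLp_nodeAverage (P.memLp_noise hL h k)) (hXL (k + 1))
    (fun ω => by
      rw [hs]
      simp only [hX, hX']
      rw [← nodeAverage_sub, ← nodeAverage_sub, P.query_sub_iterate, nodeAverage_smul])
    (fun ω => P.nodeAverage_iterate_succ α G k _)
    (by
      intro a ha
      have hmq := P.measurable_query α h.measurable_oracle k
      have hmi := P.measurable_iterate α h.measurable_oracle k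
      have hav := (continuous_nodeAverage (N := N) (d := d)).measurable
      refine P.integral_inner_nodeAverage_noise hL h k
        (φ := fun u => (nodeAverage (P.query α G k u) - nodeAverage (P.iterate α G k u))
        + s • (nodeAverage (P.iterate α G k u) - xs)
        - (P.L * α ^ 2) • P.objectiveGradient (nodeAverage (P.query α G k u))
        - (α * (1 + P.L * α)) • P.gradientBias (P.query α G k u)) ?_ (fun u u' huu => ?_) ha
      · have hg := hcg.measurable.comp (hav.comp hmq)
        have hb : Measurable fun u => P.gradientBias (P.query α G k u) :=
          (hav.comp ((P.continuous_localGradients hL).measurable.comp hmq)).sub hg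
        exact ((((hav.comp hmq).sub (hav.comp hmi)).add
          (((hav.comp hmi).sub_const xs).const_smul s)).sub (hg.const_smul (P.L * α ^ 2))).sub
          (hb.const_smul (α * (1 + P.L * α)))
      · simp only [P.query_congr α G k huu, P.iterate_congr α G k huu])
    (P.integral_norm_sq_gradientBias_le hlam hL hα hαμ hαl h hz k)
    (P.integral_norm_sq_nodeAverage_noise_le hL h k)
  have hmain := le_of_affine_recursion
    (a := fun k => ∫ ω, asgLyapunov α s P.objective xs (X k ω) (X' k ω) ∂Pr) (q := 1 - s / 2)
    (c := ((12 + 4 * P.L / P.μ) * α / s + α) * (α ^ 2 * b₀)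
      + α / 2 * (1 + P.L * α) * (P.σ ^ 2 / N))
    (by linarith) (by linarith) (by positivity) hrec k
  have h0 : ∫ ω, asgLyapunov α s P.objective xs (X 0 ω) (X' 0 ω) ∂Pr = P.Vbar₀ α xs := by
    have e : ∀ ω, asgLyapunov α s P.objective xs (X 0 ω) (X' 0 ω) = P.Vbar₀ α xs := fun ω => by
      have e0 : nodeAverage (0 : Stack N d) = 0 := by simp [nodeAverage]
      simp only [hX, hX', iterate_zero, prevIterate_zero, e0]
      rw [asgLyapunov_self hα hsq, Vbar₀, lyapunov_eq _ _ hμ.le, zero_sub, norm_neg]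
    simp [e]
  have hVi := hc.integrable_asgLyapunov (α := α) (s := s) P.continuous_objective hμ.le hz0
    (hXL k) (hXL' k)
  have hXs : MemLp (fun ω => X k ω - xs) 2 Pr := (hXL k).sub (memLp_const xs)
  have hmono := integral_mono ((memLp_two_iff_integrable_sq_norm hXs.1).1 hXs)
    (hVi.const_mul (2 / P.μ)) fun ω =>
      hc.norm_sub_sq_le_asgLyapunov hα hμ s hz0 (X k ω) (X' k ω)
  refine hmono.trans ?_
  rw [integral_const_mul]
  simp only [h0] at hmain
  have e1 : 1 - (1 - s / 2) = s / 2 := by ring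
  -- Because `α = s²/μ`, the coefficient divided by `s/2` is bounded. The accumulated bias is of
  -- order `α²`, and `α ≤ 1/μ` trades one factor of `α` for a constant.
  have hbias : ((12 + 4 * P.L / P.μ) * α / s + α) * (α ^ 2 * b₀) / (s / 2)
      ≤ α * P.biasFactor := by
    have hαs : α = s ^ 2 / P.μ := by rw [hsq]; field_simp
    have hstep : ((12 + 4 * P.L / P.μ) * α / s + α) / (s / 2)
        ≤ 2 * (12 + 4 * P.L / P.μ + 1) / P.μ := by
      have : ((12 + 4 * P.L / P.μ) * α / s + α) / (s / 2)
          = 2 * (12 + 4 * P.L / P.μ + s) / P.μ := by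
        rw [hαs]; field_simp
      rw [this]
      gcongr
    calc _ = ((12 + 4 * P.L / P.μ) * α / s + α) / (s / 2) * (α * (α * b₀)) := by ring
      _ ≤ 2 * (12 + 4 * P.L / P.μ + 1) / P.μ * (α * (1 / P.μ * b₀)) := by
          gcongr
          rwa [le_div_iff₀ hμ]
      _ = _ := by rw [biasFactor, ← hb₀]; ring
  have hnoise : α / 2 * (1 + P.L * α) * (P.σ ^ 2 / N) / (s / 2)
      = P.μ / 2 * (2 * P.σ ^ 2 * √α / (P.μ * √P.μ * N) * (1 + α * P.L)) := by
    have hss : s = √α * √P.μ := by rw [hs, Real.sqrt_mul hα.le]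
    have ha : √α ≠ 0 := (Real.sqrt_pos.2 hα).ne'
    have hm : √P.μ ≠ 0 := (Real.sqrt_pos.2 hμ).ne'
    have hαα : α = √α * √α := (Real.mul_self_sqrt hα.le).symm
    rw [hss]
    field_simp
    linear_combination P.σ ^ 2 * hαα
  rw [e1, add_div] at hmain
  calc _ ≤ 2 / P.μ * ((1 - s / 2) ^ k * P.Vbar₀ α xs + (α * P.biasFactor
        + P.μ / 2 * (2 * P.σ ^ 2 * √α / (P.μ * √P.μ * N) * (1 + α * P.L)))) := by
        gcongr
        linarith
    _ = _ := by rw [hs]; field_simp; ring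

end Average

/-! ### Signs of the constants -/

theorem B_nonneg (hL : 0 < P.L) {α : ℝ} (hα : 0 < α) {xinf : Stack N d}
    (hz : P.IsFixedPoint α xinf) : 0 ≤ P.B α xinf := by
  have hμ := P.mu_pos
  have hV : 0 ≤ P.V₀ α xinf := by
    rw [V₀, lyapunov_eq _ _ hμ.le]
    have h1 := (P.curvatureBounds_penalized hα).lower_of_stationary
      (P.penalizedGradient_eq_zero hα hz) 0
    have h2 : 0 ≤ P.μ / 2 * ‖xinf‖ ^ 2 := by positivity
    have h3 : 0 ≤ P.μ / 2 * ‖0 - xinf‖ ^ 2 := by positivity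
    linarith
  have hl : 0 ≤ 2 - P.lambdaMin + α * P.L := by
    have := P.lambdaMin_le_one
    have : 0 < α * P.L := by positivity
    linarith
  unfold B
  positivity

/-- With `s = √(αμ)` and nonnegative terms dropped, `8 - 6s + 2s²` remains, which is at least `4` on
`[0, 1]`. -/
theorem one_le_H₁ (hL : 0 < P.L) {α : ℝ} (hα : 0 < α) (hαμ : α * P.μ ≤ 1) : 1 ≤ P.H₁ α := by
  have hμ := P.mu_pos
  have hs0 := Real.sqrt_nonneg (α * P.μ)
  have hs1 : √(α * P.μ) ≤ 1 := Real.sqrt_le_one.2 hαμ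
  have hsq : √(α * P.μ) ^ 2 = α * P.μ := Real.sq_sqrt (by positivity)
  set s := √(α * P.μ) with hs
  have h1 : 0 ≤ 2 * P.L ^ 2 * α / P.μ := by positivity
  have h2 : 0 ≤ (P.L * α + P.μ * α) * s := by positivity
  have h3 : 0 < α * P.μ := by positivity
  unfold H₁
  rw [← hs]
  nlinarith

end DecentralizedProblem
end

/-! ### Absorption by the stated constants and the main theorem -/

noncomputable section

namespace DecentralizedProblem

variable {N d : ℕ} (P : DecentralizedProblem N d)

theorem DySq_nonneg {α : ℝ} {xs : Vec d} {xinf : Stack N d} (hB : 0 ≤ P.B α xinf) :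
    0 ≤ P.DySq α xs xinf := by
  unfold DySq
  positivity

theorem H₃_nonneg {α : ℝ} {xs : Vec d} {xinf : Stack N d} (hB : 0 ≤ P.B α xinf) :
    0 ≤ P.H₃ α xs xinf := by
  unfold H₃
  positivity

/-- Only the `C₀` summand is kept, together with `(1 - γ)² ≤ 1` and `(1 + β)² + β² ≥ 1`. -/
theorem le_H₂ (hlam : 0 < P.lambdaMin) {C₀ α : ℝ} (hC₀ : 0 ≤ C₀) (hα : 0 < α)
    (hαμ : α * P.μ ≤ 1) {xs : Vec d} {xinf : Stack N d}
    (hB : 0 ≤ P.B α xinf) : 16 * P.L ^ 2 / N * C₀ ≤ P.H₂ C₀ α xs xinf := by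
  have hγ := P.gamma_lt_one hlam
  have hγ0 := P.gamma_pos hlam
  have hD := P.DySq_nonneg (xs := xs) hB
  have hβ := P.beta_nonneg hαμ
  have h1 : 0 < (1 - P.gamma) ^ 2 := by
    have : 0 < 1 - P.gamma := by linarith
    positivity
  have h2 : (1 - P.gamma) ^ 2 ≤ 1 := by nlinarith
  have h3 : 8 * C₀ ≤ 8 * C₀ / (1 - P.gamma) ^ 2 := by
    rw [le_div_iff₀ h1]
    exact mul_le_of_le_one_right (by positivity) h2
  have h4 : 0 ≤ 4 * P.DySq α xs xinf * α / (1 - P.gamma) ^ 2 := by positivity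
  have h5 : 0 ≤ 4 * P.σ ^ 2 * N * α / (1 - P.gamma) ^ 2 := by positivity
  have h6 : 1 ≤ (1 + P.beta α) ^ 2 + P.beta α ^ 2 := by nlinarith
  unfold H₂
  calc 16 * P.L ^ 2 / N * C₀ = 2 / N * P.L ^ 2 * 1 * (8 * C₀) := by ring
    _ ≤ _ := by gcongr; linarith

/-- The constant `C₀` absorbing the network effects. -/
def networkConstant : ℝ :=
  1 + |P.μ * P.biasFactor * N / (16 * P.L ^ 2)| + |P.consensusBound / P.μ|

theorem networkConstant_pos : 0 < P.networkConstant := by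
  unfold networkConstant
  positivity

end DecentralizedProblem
end

open DecentralizedProblem in
theorem mainTheorem5 {N d : ℕ} (P : DecentralizedProblem N d) (hlam : 0 < P.lambdaMin)
    (xs : Vec d) (hxs : ∀ x, P.objective xs ≤ P.objective x) :
    ∃ C₀ : ℝ, 0 < C₀ ∧
      ∀ α : ℝ, 0 < α → α ≤ min (1 / (P.L + P.μ)) (P.lambdaMin / P.L) →
      ∀ xinf : Stack N d, P.IsFixedPoint α xinf →
      ∀ (Ω Z : Type*) [MeasurableSpace Ω] [MeasurableSpace Z] (Pr : Measure Ω)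
        [IsProbabilityMeasure Pr] (G : Fin N → Vec d → Z → Vec d) (w : ℕ → Fin N → Ω → Z),
      P.NoiseAssumption Pr α (P.beta α) G w →
      ∀ x : ℕ → Ω → Stack N d,
      (∀ k ω, x k ω = dasgX P.W α (P.beta α) G 0 0 (fun t j => w t j ω) k) →
      ∀ k : ℕ,
        (Integrable (fun ω => ‖nodeAverage (x k ω) - xs‖ ^ 2) Pr ∧
          ∫ ω, ‖nodeAverage (x k ω) - xs‖ ^ 2 ∂Pr ≤
            (1 - √(α * P.μ) / 2) ^ k * (2 * P.Vbar₀ α xs / P.μ)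
            + 8 / (P.gamma ^ 2 * P.μ * √P.μ) * √α * P.H₁ α * P.H₃ α xs xinf
                * powerQuotient (P.gamma ^ 2) (1 - √(α * P.μ) / 2) k
            + 2 / P.μ ^ 2 * α * P.H₁ α * P.H₂ C₀ α xs xinf
            + 2 * P.σ ^ 2 * √α / (P.μ * √P.μ * N) * (1 + √(α * P.μ) / 2) * (1 + α * P.L)) ∧
        ∀ i : Fin N,
          Integrable (fun ω => ‖x k ω i - xs‖ ^ 2) Pr ∧
          ∫ ω, ‖x k ω i - xs‖ ^ 2 ∂Pr ≤
            (1 - √(α * P.μ) / 2) ^ k * (4 * P.Vbar₀ α xs / P.μ)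
            + 16 / (P.gamma ^ 2 * P.μ * √P.μ) * √α * P.H₁ α * P.H₃ α xs xinf
                * powerQuotient (P.gamma ^ 2) (1 - √(α * P.μ) / 2) k
            + 4 / P.μ ^ 2 * α * P.H₁ α * P.H₂ C₀ α xs xinf
            + 16 * P.gamma ^ (2 * k) * (P.B α xinf + ‖DecentralizedProblem.copies N xs‖ ^ 2)
            + 8 * P.DySq α xs xinf * α ^ 2 / (1 - P.gamma) ^ 2
            + 8 * P.σ ^ 2 * N * α ^ 2 / (1 - P.gamma) ^ 2
            + 16 * C₀ * α / (1 - P.gamma) ^ 2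
            + 4 * P.σ ^ 2 * √α / (P.μ * √P.μ * N) * (1 + √(α * P.μ) / 2) * (1 + α * P.L) := by
  -- The second summand of the constant serves the bias of the average and the third the
  -- disagreement. The absolute values make it positive before `L > 0` is available.
  refine ⟨P.networkConstant, P.networkConstant_pos, ?_⟩
  intro α hα hαle xinf hz Ω Z _ _ Pr _ G w h x hx k
  have hμ := P.mu_pos
  have hN := P.numNodes_pos
  have hα1 := hαle.trans (min_le_left _ _)
  have hα2 := hαle.trans (min_le_right _ _)
  -- Positivity of `L` comes from the existence of an admissible stepsize: for `L ≤ 0` the quotient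
  -- `λ_N / L` is nonpositive, with division by zero giving zero.
  have hL : 0 < P.L := by
    by_contra! hc
    exact absurd (hα.trans_le hα2) (not_lt.2 (div_nonpos_of_nonneg_of_nonpos hlam.le hc))
  have hαLμ : α * (P.L + P.μ) ≤ 1 := (le_div_iff₀ (by positivity)).1 hα1
  have hαl : α * P.L ≤ P.lambdaMin := (le_div_iff₀ hL).1 hα2
  have hαL : α * P.L ≤ 1 := by nlinarith
  have hαμ : α * P.μ ≤ 1 := by nlinarith
  have hx' : ∀ ω, x k ω = P.iterate α G k (inputs w ω) := fun ω => hx k ω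
  simp only [hx']
  have hxL := P.memLp_iterate hL h k
  have hav : MemLp (fun ω => nodeAverage (P.iterate α G k (inputs w ω)) - xs) 2 Pr :=
    (memLp_nodeAverage hxL).sub (memLp_const xs)
  have havi := (memLp_two_iff_integrable_sq_norm hav.1).1 hav
  have hB := P.B_nonneg hL hα hz
  have hC := P.networkConstant_pos
  have hH₁ := P.one_le_H₁ hL hα hαμ
  have hH₂ := P.le_H₂ hlam hC.le hα hαμ (xs := xs) hB
  have hH₃ := P.H₃_nonneg (xs := xs) hB
  have hD := P.DySq_nonneg (xs := xs) hB
  have hγ0 := P.gamma_pos hlam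
  have hγ1 := P.gamma_lt_one hlam
  have hs0 := Real.sqrt_nonneg (α * P.μ)
  have hs1 : √(α * P.μ) ≤ 1 := Real.sqrt_le_one.2 hαμ
  have hpq : 0 ≤ powerQuotient (P.gamma ^ 2) (1 - √(α * P.μ) / 2) k :=
    powerQuotient_nonneg (by positivity) (by linarith) k
  have hR : 0 ≤ 8 / (P.gamma ^ 2 * P.μ * √P.μ) * √α * P.H₁ α * P.H₃ α xs xinf
      * powerQuotient (P.gamma ^ 2) (1 - √(α * P.μ) / 2) k := by positivity
  have hbias : 2 / P.μ * (α * P.biasFactor)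
      ≤ 2 / P.μ ^ 2 * α * P.H₁ α * P.H₂ P.networkConstant α xs xinf := by
    have h1 : P.μ * P.biasFactor ≤ P.H₂ P.networkConstant α xs xinf := by
      refine le_trans ?_ hH₂
      have h2 := le_abs_self (P.μ * P.biasFactor * N / (16 * P.L ^ 2))
      have h3 := abs_nonneg (P.consensusBound / P.μ)
      calc P.μ * P.biasFactor
          = 16 * P.L ^ 2 / N * (P.μ * P.biasFactor * N / (16 * P.L ^ 2)) := by field_simp
        _ ≤ _ := by
            gcongr
            unfold networkConstant
            linarith
    have h0 : 0 ≤ P.H₂ P.networkConstant α xs xinf :=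
      le_trans (by positivity) hH₂
    have h2 := P.biasFactor_nonneg hlam hL
    calc 2 / P.μ * (α * P.biasFactor) = 2 / P.μ ^ 2 * α * 1 * (P.μ * P.biasFactor) := by field_simp
      _ ≤ _ := by gcongr
  have hnoise : 2 * P.σ ^ 2 * √α / (P.μ * √P.μ * N) * (1 + α * P.L)
      ≤ 2 * P.σ ^ 2 * √α / (P.μ * √P.μ * N) * (1 + √(α * P.μ) / 2) * (1 + α * P.L) := by
    gcongr
    exact le_mul_of_one_le_right (by positivity) (by linarith)
  have hmain := P.integral_norm_sq_nodeAverage_sub_le hlam hL hα hαL hαμ hαl h hz hxs k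
  refine ⟨⟨havi, by linarith⟩, fun i => ?_⟩
  have hi : MemLp (fun ω => P.iterate α G k (inputs w ω) i - xs) 2 Pr :=
    (memLp_stack_apply hxL i).sub (memLp_const xs)
  have hii := (memLp_two_iff_integrable_sq_norm hi.1).1 hi
  refine ⟨hii, ?_⟩
  have hdi := integrable_disagreement hxL
  -- The error of node `i` splits at the average. This doubles every term of the averaged bound and
  -- adds twice the total disagreement.
  have hmono := integral_mono hii ((havi.const_mul 2).add (hdi.const_mul 2)) fun ω => by
    have h1 := norm_add_sq_le_two (nodeAverage (P.iterate α G k (inputs w ω)) - xs)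
      (P.iterate α G k (inputs w ω) i - nodeAverage (P.iterate α G k (inputs w ω)))
    rw [add_comm (nodeAverage _ - xs), sub_add_sub_cancel] at h1
    have h2 := Finset.single_le_sum (f := fun j => ‖P.iterate α G k (inputs w ω) j
      - nodeAverage (P.iterate α G k (inputs w ω))‖ ^ 2) (fun _ _ => by positivity)
      (Finset.mem_univ i)
    simp only [Pi.add_apply]
    simp only at h2
    linarith
  rw [integral_add' (havi.const_mul 2) (hdi.const_mul 2), integral_const_mul,
    integral_const_mul] at hmono
  have hdis := P.integral_disagreement_le hlam hL hα hαμ hαl h hz k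
  have hγ2 : 0 < (1 - P.gamma) ^ 2 := by
    have : 0 < 1 - P.gamma := by linarith
    positivity
  -- One factor `α` is traded for `1/μ`, which is why `consensusBound / μ` enters `networkConstant`.
  have hcons : 2 * (α ^ 2 * P.consensusBound)
      ≤ 16 * P.networkConstant * α / (1 - P.gamma) ^ 2 := by
    have hcb := P.consensusBound_nonneg hlam
    have h1 : P.consensusBound / P.μ ≤ P.networkConstant := by
      have h2 := abs_nonneg (P.μ * P.biasFactor * N / (16 * P.L ^ 2))
      have h3 := le_abs_self (P.consensusBound / P.μ)
      unfold networkConstant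
      linarith
    rw [le_div_iff₀ hγ2]
    calc 2 * (α ^ 2 * P.consensusBound) * (1 - P.gamma) ^ 2
        ≤ 2 * (α ^ 2 * P.consensusBound) * 1 := by gcongr; nlinarith
      _ = 2 * α * (α * P.μ) * (P.consensusBound / P.μ) := by field_simp
      _ ≤ 2 * α * 1 * P.networkConstant := by gcongr
      _ ≤ _ := by nlinarith [mul_pos hα hC]
  have p1 : 0 ≤ 16 * P.gamma ^ (2 * k) * (P.B α xinf + ‖DecentralizedProblem.copies N xs‖ ^ 2) := by
    positivity
  have p2 : 0 ≤ 8 * P.DySq α xs xinf * α ^ 2 / (1 - P.gamma) ^ 2 := by positivity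
  have p3 : 0 ≤ 8 * P.σ ^ 2 * N * α ^ 2 / (1 - P.gamma) ^ 2 := by positivity
  have e : (1 - √(α * P.μ) / 2) ^ k * (4 * P.Vbar₀ α xs / P.μ)
      = 2 * ((1 - √(α * P.μ) / 2) ^ k * (2 * P.Vbar₀ α xs / P.μ)) := by ring
  have e2 : 16 / (P.gamma ^ 2 * P.μ * √P.μ) * √α * P.H₁ α * P.H₃ α xs xinf
      * powerQuotient (P.gamma ^ 2) (1 - √(α * P.μ) / 2) k
      = 2 * (8 / (P.gamma ^ 2 * P.μ * √P.μ) * √α * P.H₁ α * P.H₃ α xs xinf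
      * powerQuotient (P.gamma ^ 2) (1 - √(α * P.μ) / 2) k) := by ring
  have e3 : 4 / P.μ ^ 2 * α * P.H₁ α * P.H₂ P.networkConstant α xs xinf
      = 2 * (2 / P.μ ^ 2 * α * P.H₁ α * P.H₂ P.networkConstant α xs xinf) := by ring
  have e4 : 4 * P.σ ^ 2 * √α / (P.μ * √P.μ * N) * (1 + √(α * P.μ) / 2) * (1 + α * P.L)
      = 2 * (2 * P.σ ^ 2 * √α / (P.μ * √P.μ * N) * (1 + √(α * P.μ) / 2) * (1 + α * P.L)) := by
    ring
  rw [e, e2, e3, e4]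
  linarith
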